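/- **Setting.** Fix $h>0$, put $t_k=kh$ ($k\in\mathbb N=\{0,1,2,\dots\}$), and consider the linear periodic jump-flow (LPJF) system with state $\xi(t)\in\mathbb R^n$ and real matrices $\mathcal A_c,\mathcal B_c,\mathcal C_c,\mathcal D_c,\mathcal A_d,\mathcal B_d,\mathcal C_d,\mathcal D_d$ of compatible sizes, $$\dot\xi(t)=\mathcal A_c\xi(t)+\mathcal B_cw_c(t),\qquad z_c(t)=\mathcal C_c\xi(t)+\mathcal D_cw_c(t)\qquad (t\in(t_k,t_{k+1}]),$$ $$\xi(t_k^+)=\mathcal A_d\xi(t_k)+\mathcal B_dw_d[k],\qquad z_d[k]=\mathcal C_d\xi(t_k)+\mathcal D_dw_d[k].$$ Solutions are left-continuous, absolutely continuous along flows (the differential equation holds almost everywhere), and $w_c$ is measurable and essentially bounded on the time window considered. The supply functions are $$s_c(w_c,z_c)=\begin{bmatrix}w_c\\z_c\end{bmatrix}^{\top}\begin{bmatrix}Q_c&S_c\\S_c^\top&R_c\end{bmatrix}\begin{bmatrix}w_c\\z_c\end{bmatrix},\qquad s_d(w_d,z_d)=\begin{bmatrix}w_d\\z_d\end{bmatrix}^{\top}\begin{bmatrix}Q_d&S_d\\S_d^\top&R_d\end{bmatrix}\begin{bmatrix}w_d\\z_d\end{bmatrix},$$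 with $Q_c,R_c$ symmetric and $R_d=-E_d^\top\Pi_d^{-1}E_d$. The system is *dissipative* with respect to $(s_c,s_d)$ if there is a function $S:\mathbb R^n\times\mathbb R_{\ge0}\to\mathbb R$ such that for all $t_1\ge t_0\ge0$ and all solutions on $[t_0,t_1]$, the function $t\mapsto s_c(w_c(t),z_c(t))$ is integrable on $[t_0,t_1]$ and $$S(\xi(t_1),t_1)\le S(\xi(t_0),t_0)+\int_{t_0}^{t_1}s_c(w_c(t),z_c(t))\,dt+\sum_{k\in\mathbb N:\ t_0\le kh<t_1}s_d(w_d[k],z_d[k]).$$ Its origin is *globally exponentially stable (GES)* if there are $c,\alpha>0$ such that all solutions with $w_c=0$, $w_d=0$ satisfy $\|\xi(t)\|\le ce^{-\alpha t}\|\xi(0)\|$ for all $t\ge0$. Let $M_1=\mathcal C_c^\top R_c\mathcal C_c$, $M_3=\mathcal C_c^\top S_c^\top+\mathcal C_c^\top R_c\mathcal D_c$, $M_2=Q_c+S_c\mathcal D_c+\mathcal D_c^\top S_c^\top+\mathcal D_c^\top R_c\mathcal D_c$, $$H=\begin{bmatrix}\mathcal A_c-\mathcal B_cM_2^{-1}M_3^\top&\mathcal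 B_cM_2^{-1}\mathcal B_c^\top\\M_1-M_3M_2^{-1}M_3^\top&-(\mathcal A_c-\mathcal B_cM_2^{-1}M_3^\top)^\top\end{bmatrix},\qquad F(\tau)=e^{-H\tau}=\begin{bmatrix}F_{11}(\tau)&F_{12}(\tau)\\F_{21}(\tau)&F_{22}(\tau)\end{bmatrix}.$$ **Theorem.** Assume that $\Pi_d\succ0$, that $M_2\succ0$, and that $F_{11}(t)$ is invertible for all $t\in[0,h]$. Let $\hat A=F_{11}^{-1}(h)$ and let $\hat B,\hat C$ be real matrices with $\hat B\hat B^\top=-F_{11}^{-1}(h)F_{12}(h)$ and $\hat C^\top\hat C=F_{21}(h)F_{11}^{-1}(h)$. Suppose that there is a matrix $P_h$ such that the symmetric block matrix $$\begin{bmatrix}P_h&\star&\star&\star&\star&\star\\S_d\mathcal C_d&Q_d+S_d\mathcal D_d+\mathcal D_d^\top S_d^\top&\star&\star&\star&\star\\E_d\mathcal C_d&E_d\mathcal D_d&\Pi_d&\star&\star&\star\\\hat C\mathcal A_d&\hat C\mathcal B_d&0&I&\star&\star\\P_h\hat A\mathcal A_d&P_h\hat A\mathcal B_d&0&0&P_h&\star\\0&0&0&0&\hat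 B^\top P_h&I\end{bmatrix}$$ is positive definite. Then the LPJF system is dissipative with respect to $(s_c,s_d)$. If moreover $R_c\preceq0$, then its origin is GES. -/

import Mathlib

open MeasureTheory Filter Topology Matrix

/-- The data of a linear periodic jump-flow system with state `ξ ∈ ℝⁿ`, flow and jump disturbances
`w_c, w_d`, and flow and jump outputs `z_c, z_d`:
`ξ' = Ac ξ + Bc w_c`, `z_c = Cc ξ + Dc w_c` along flows, and
`ξ(t_k⁺) = Ad ξ(t_k) + Bd w_d[k]`, `z_d[k] = Cd ξ(t_k) + Dd w_d[k]` at the jump times `t_k = k h`. -/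
structure LPJF (n wc wd zc zd : ℕ) where
  Ac : Matrix (Fin n) (Fin n) ℝ
  Bc : Matrix (Fin n) (Fin wc) ℝ
  Cc : Matrix (Fin zc) (Fin n) ℝ
  Dc : Matrix (Fin zc) (Fin wc) ℝ
  Ad : Matrix (Fin n) (Fin n) ℝ
  Bd : Matrix (Fin n) (Fin wd) ℝ
  Cd : Matrix (Fin zd) (Fin n) ℝ
  Dd : Matrix (Fin zd) (Fin wd) ℝ

/-- The quadratic supply `[w; z]ᵀ [Q S; Sᵀ R] [w; z]`. -/
def quadSupply {a b : ℕ} (Q : Matrix (Fin a) (Fin a) ℝ) (S : Matrix (Fin a) (Fin b) ℝ)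
    (R : Matrix (Fin b) (Fin b) ℝ) (w : Fin a → ℝ) (z : Fin b → ℝ) : ℝ :=
  Sum.elim w z ⬝ᵥ (fromBlocks Q S Sᵀ R *ᵥ Sum.elim w z)

namespace LPJF

variable {n wc wd zc zd : ℕ} (T : LPJF n wc wd zc zd)

/-- `ξ` is a (left-continuous, Carathéodory) solution of the system on the time window `[t₀, t₁]`
for the inputs `w` (flow) and `v` (jump). The flow input is measurable and essentially bounded on
the window, the differential equation holds in integrated form on every part of an interval
`(k h, (k + 1) h]` inside the window, and every jump time `k h` with `t₀ ≤ k h < t₁` carries a jump,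
`ξ (k h)` being the state before the jump. -/
structure IsSolutionOn (h t₀ t₁ : ℝ) (ξ : ℝ → Fin n → ℝ) (w : ℝ → Fin wc → ℝ)
    (v : ℕ → Fin wd → ℝ) : Prop where
  input : MemLp w ⊤ (volume.restrict (Set.Icc t₀ t₁))
  flow : ∀ (k : ℕ) (s t : ℝ), k * h < s → s ≤ t → t ≤ (k + 1) * h → t₀ ≤ s → t ≤ t₁ →
    IntervalIntegrable (fun r => T.Ac *ᵥ ξ r + T.Bc *ᵥ w r) volume s t ∧
      ξ t = ξ s + ∫ r in s..t, (T.Ac *ᵥ ξ r + T.Bc *ᵥ w r)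
  jump : ∀ k : ℕ, t₀ ≤ k * h → k * h < t₁ →
    Tendsto ξ (𝓝[>] (k * h)) (𝓝 (T.Ad *ᵥ ξ (k * h) + T.Bd *ᵥ v k))

/-- Dissipativity with respect to a flow supply `sc` and a jump supply `sd`: there is a storage
function `S` such that the dissipation inequality holds along every trajectory on every window
`[t₀, t₁]`. The sum runs over the jumps `k` with `t₀ ≤ k h < t₁`. The flow supply is required to be
integrable, so that its integral is meaningful. -/
def Dissipative (h : ℝ) (sc : (Fin wc → ℝ) → (Fin zc → ℝ) → ℝ)
    (sd : (Fin wd → ℝ) → (Fin zd → ℝ) → ℝ) : Prop :=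
  ∃ S : (Fin n → ℝ) → ℝ → ℝ, ∀ (t₀ t₁ : ℝ), 0 ≤ t₀ → t₀ ≤ t₁ →
    ∀ (ξ : ℝ → Fin n → ℝ) (w : ℝ → Fin wc → ℝ) (v : ℕ → Fin wd → ℝ),
      T.IsSolutionOn h t₀ t₁ ξ w v →
        IntervalIntegrable (fun t => sc (w t) (T.Cc *ᵥ ξ t + T.Dc *ᵥ w t)) volume t₀ t₁ ∧
        S (ξ t₁) t₁ ≤ S (ξ t₀) t₀ + (∫ t in t₀..t₁, sc (w t) (T.Cc *ᵥ ξ t + T.Dc *ᵥ w t)) +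
          ∑ k ∈ Finset.Ico ⌈t₀ / h⌉₊ ⌈t₁ / h⌉₊,
            sd (v k) (T.Cd *ᵥ ξ (k * h) + T.Dd *ᵥ v k)

/-- The origin is globally exponentially stable: all solutions on `[0, ∞)` with zero disturbances
satisfy `‖ξ(t)‖ ≤ c e^{-α t} ‖ξ(0)‖` in the Euclidean norm, with `c, α > 0` independent of the
solution. -/
def GES (h : ℝ) : Prop :=
  ∃ c > 0, ∃ α > 0, ∀ ξ : ℝ → Fin n → ℝ,
    (∀ t₁ : ℝ, 0 ≤ t₁ → T.IsSolutionOn h 0 t₁ ξ (fun _ => 0) (fun _ => 0)) →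
      ∀ t : ℝ, 0 ≤ t →
        ‖WithLp.toLp 2 (ξ t)‖ ≤ c * Real.exp (-α * t) * ‖WithLp.toLp 2 (ξ 0)‖

/-- The block `M₁` of the flow supply expressed in the variables `(ξ, w_c)`. -/
def M₁ (Rc : Matrix (Fin zc) (Fin zc) ℝ) : Matrix (Fin n) (Fin n) ℝ :=
  T.Ccᵀ * Rc * T.Cc

/-- The block `M₃` of the flow supply expressed in the variables `(ξ, w_c)`. -/
def M₃ (Sc : Matrix (Fin wc) (Fin zc) ℝ) (Rc : Matrix (Fin zc) (Fin zc) ℝ) :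
    Matrix (Fin n) (Fin wc) ℝ :=
  T.Ccᵀ * Scᵀ + T.Ccᵀ * Rc * T.Dc

/-- The block `M₂` of the flow supply expressed in the variables `(ξ, w_c)`. -/
def M₂ (Qc : Matrix (Fin wc) (Fin wc) ℝ) (Sc : Matrix (Fin wc) (Fin zc) ℝ)
    (Rc : Matrix (Fin zc) (Fin zc) ℝ) : Matrix (Fin wc) (Fin wc) ℝ :=
  Qc + Sc * T.Dc + T.Dcᵀ * Scᵀ + T.Dcᵀ * Rc * T.Dc

/-- The Hamiltonian matrix `H`. -/
noncomputable def hamiltonian (Qc : Matrix (Fin wc) (Fin wc) ℝ) (Sc : Matrix (Fin wc) (Fin zc) ℝ)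
    (Rc : Matrix (Fin zc) (Fin zc) ℝ) : Matrix (Fin n ⊕ Fin n) (Fin n ⊕ Fin n) ℝ :=
  fromBlocks
    (T.Ac - T.Bc * (T.M₂ Qc Sc Rc)⁻¹ * (T.M₃ Sc Rc)ᵀ)
    (T.Bc * (T.M₂ Qc Sc Rc)⁻¹ * T.Bcᵀ)
    (T.M₁ Rc - T.M₃ Sc Rc * (T.M₂ Qc Sc Rc)⁻¹ * (T.M₃ Sc Rc)ᵀ)
    (-(T.Ac - T.Bc * (T.M₂ Qc Sc Rc)⁻¹ * (T.M₃ Sc Rc)ᵀ)ᵀ)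

/-- `F(τ) = exp(-H τ)`; its blocks are `(F τ).toBlocks₁₁` and so on. -/
noncomputable def F (Qc : Matrix (Fin wc) (Fin wc) ℝ) (Sc : Matrix (Fin wc) (Fin zc) ℝ)
    (Rc : Matrix (Fin zc) (Fin zc) ℝ) (τ : ℝ) : Matrix (Fin n ⊕ Fin n) (Fin n ⊕ Fin n) ℝ :=
  NormedSpace.exp (-(τ • T.hamiltonian Qc Sc Rc))

/-- The symmetric `6 × 6` block matrix of the linear matrix inequality, with block rows (and
columns) of sizes `n, w_d, e, r, n, q`:

  row 1: `P`
  row 2: `Sd Cd`,   `Qd + Sd Dd + Ddᵀ Sdᵀ`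
  row 3: `Ed Cd`,   `Ed Dd`,     `Πd`
  row 4: `Ch Ad`,   `Ch Bd`,     `0`, `I`
  row 5: `P Ah Ad`, `P Ah Bd`,   `0`, `0`, `P`
  row 6: `0`,       `0`,         `0`, `0`, `Bhᵀ P`, `I`

grouped as (rows 1-2) and (rows 3-6). -/
def lmi {e r q : ℕ} (Qd : Matrix (Fin wd) (Fin wd) ℝ) (Sd : Matrix (Fin wd) (Fin zd) ℝ)
    (Ed : Matrix (Fin e) (Fin zd) ℝ) (Pd : Matrix (Fin e) (Fin e) ℝ)
    (Ah : Matrix (Fin n) (Fin n) ℝ) (Bh : Matrix (Fin n) (Fin q) ℝ)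
    (Ch : Matrix (Fin r) (Fin n) ℝ) (P : Matrix (Fin n) (Fin n) ℝ) :
    Matrix ((Fin n ⊕ Fin wd) ⊕ (Fin e ⊕ (Fin r ⊕ (Fin n ⊕ Fin q))))
      ((Fin n ⊕ Fin wd) ⊕ (Fin e ⊕ (Fin r ⊕ (Fin n ⊕ Fin q)))) ℝ :=
  let X : Matrix (Fin n ⊕ Fin wd) (Fin n ⊕ Fin wd) ℝ :=
    fromBlocks P (Sd * T.Cd)ᵀ
      (Sd * T.Cd) (Qd + Sd * T.Dd + T.Ddᵀ * Sdᵀ)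
  let Y : Matrix (Fin e ⊕ (Fin r ⊕ (Fin n ⊕ Fin q))) (Fin n ⊕ Fin wd) ℝ :=
    fromRows (fromCols (Ed * T.Cd) (Ed * T.Dd))
      (fromRows (fromCols (Ch * T.Ad) (Ch * T.Bd))
        (fromRows (fromCols (P * Ah * T.Ad) (P * Ah * T.Bd))
          0))
  let Z : Matrix (Fin e ⊕ (Fin r ⊕ (Fin n ⊕ Fin q))) (Fin e ⊕ (Fin r ⊕ (Fin n ⊕ Fin q))) ℝ :=
    fromBlocks Pd 0 0
      (fromBlocks 1 0 0
        (fromBlocks P (Bhᵀ * P)ᵀ (Bhᵀ * P) 1))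
  fromBlocks X Yᵀ Y Z

end LPJF

/-! The storage function is `ξᵀ K(r) ξ`, where `r` is the time left until the next jump and `K`
solves the Riccati equation `K' = -M + AᵀK + KA + KNK`, `K(0) = P`, with `A, N, M` the blocks `H₁₁,
H₁₂, H₂₁` of the Hamiltonian. Completing the square in `w_c` shows that along flows its growth rate
is at most the flow supply (`flow_dissipation`).

The Riccati equation is linearised by `H`: if `(X, Y)` is `F(r)` applied to `(1, P)`, then `K = Y
X⁻¹`. This needs `X = F₁₁ + F₁₂ P` invertible on all of `[0, h]`. Since `F` is symplectic and `N ⪰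
0`, the form of `-F₁₁⁻¹F₁₂` is nondecreasing, hence at most its value `B̂B̂ᵀ` at `h`. A kernel
vector `x` of `X` would give `xᵀPx ≤ (Px)ᵀB̂B̂ᵀ(Px)`, contradicting blocks 5 and 6 of the LMI
(`isUnit_toBlocks₁₁_add`, `lmi_quad_lt`).

At the end of the interval `K(h) = ĈᵀĈ + ÂᵀP(1 - B̂B̂ᵀP)⁻¹Â` (`riccati_eq`). Eliminating the last
four blocks of the LMI turns it into the jump inequality, which bounds the form of `K(h)` after the
jump by that of `P` before it plus the jump supply (`exists_quad_lmi_eq`). Flow and jump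
inequalities add up over any window, which is dissipativity.

For GES, `R_c ⪯ 0` and the shape of `R_d` make both supplies nonpositive at zero disturbance, and
strictness of the LMI leaves a margin `ε|x|²` at each jump. So `ξᵀPξ` contracts geometrically at
jump times, while growth in between is bounded. -/

section MatrixCalculus

/-! ### Derivatives of matrix-valued curves; the operator norm is used only in this section. -/

open scoped Matrix.Norms.Operator

variable {m : Type*} [Fintype m]

theorem HasDerivAt.matrix_inv [DecidableEq m] {X : ℝ → Matrix m m ℝ} {X' : Matrix m m ℝ} {t : ℝ}
    (hX : HasDerivAt X X' t) (hu : IsUnit (X t)) :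
    HasDerivAt (fun s => (X s)⁻¹) (-((X t)⁻¹ * X' * (X t)⁻¹)) t := by
  obtain ⟨u, hu⟩ := hu
  have h := (hu ▸ hasFDerivAt_ringInverse (𝕜 := ℝ) u).comp_hasDerivAt t hX
  have e : (fun s => (X s)⁻¹) = Ring.inverse ∘ X := by
    funext s; simp [Matrix.nonsing_inv_eq_ringInverse]
  have e' : ((u⁻¹ : (Matrix m m ℝ)ˣ) : Matrix m m ℝ) = (X t)⁻¹ := by
    rw [← hu, Matrix.coe_units_inv]
  rw [e]
  simp only [e'] at h
  exact h

theorem LinearMap.hasDerivAt_comp {E E' : Type*} [NormedAddCommGroup E] [NormedSpace ℝ E]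
    [FiniteDimensional ℝ E] [NormedAddCommGroup E'] [NormedSpace ℝ E'] (L : E →ₗ[ℝ] E')
    {X : ℝ → E} {X' : E} {t : ℝ} (hX : HasDerivAt X X' t) :
    HasDerivAt (fun s => L (X s)) (L X') t :=
  (LinearMap.toContinuousLinearMap L).hasFDerivAt.comp_hasDerivAt t hX

/-- The bilinear form `x ⬝ᵥ M y` as a linear function of `M`. -/
def quadAt (x y : m → ℝ) : Matrix m m ℝ →ₗ[ℝ] ℝ where
  toFun M := x ⬝ᵥ (M *ᵥ y)
  map_add' M N := by simp [add_mulVec, dotProduct_add]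
  map_smul' c M := by simp [smul_mulVec, dotProduct_smul]

/-- The submatrix picked by two index maps, as a linear function of the matrix. -/
def blockMap (f g : m → m ⊕ m) : Matrix (m ⊕ m) (m ⊕ m) ℝ →ₗ[ℝ] Matrix m m ℝ where
  toFun M := M.submatrix f g
  map_add' _ _ := rfl
  map_smul' _ _ := rfl

theorem hasDerivAt_exp_neg_smul [DecidableEq m] (H : Matrix m m ℝ) (τ : ℝ) :
    HasDerivAt (fun τ : ℝ => NormedSpace.exp (-(τ • H))) (-H * NormedSpace.exp (-(τ • H))) τ := by
  have := hasDerivAt_exp_smul_const' (𝕂 := ℝ) (-H) τ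
  simp only [smul_neg] at this
  exact this

theorem LinearMap.hasDerivAt_matrix {m' : Type*} [Fintype m']
    (L : Matrix m m ℝ →ₗ[ℝ] Matrix m' m' ℝ)
    {X : ℝ → Matrix m m ℝ} {X' : Matrix m m ℝ} {t : ℝ} (hX : HasDerivAt X X' t) :
    HasDerivAt (fun s => L (X s)) (L X') t := L.hasDerivAt_comp hX

theorem HasDerivAt.matrix_mul [DecidableEq m] {X Y : ℝ → Matrix m m ℝ}
    {X' Y' : Matrix m m ℝ} {t : ℝ} (hX : HasDerivAt X X' t) (hY : HasDerivAt Y Y' t) :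
    HasDerivAt (fun s => X s * Y s) (X' * Y t + X t * Y') t := HasDerivAt.mul hX hY

theorem HasDerivAt.matrix_add {X Y : ℝ → Matrix m m ℝ}
    {X' Y' : Matrix m m ℝ} {t : ℝ} (hX : HasDerivAt X X' t) (hY : HasDerivAt Y Y' t) :
    HasDerivAt (fun s => X s + Y s) (X' + Y') t := HasDerivAt.add hX hY

theorem HasDerivAt.matrix_mul_const [DecidableEq m] {X : ℝ → Matrix m m ℝ}
    {X' : Matrix m m ℝ} {t : ℝ} (hX : HasDerivAt X X' t) (P : Matrix m m ℝ) :
    HasDerivAt (fun s => X s * P) (X' * P) t := HasDerivAt.mul_const hX P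

theorem HasDerivAt.matrix_neg {X : ℝ → Matrix m m ℝ} {X' : Matrix m m ℝ} {t : ℝ}
    (hX : HasDerivAt X X' t) : HasDerivAt (fun s => -X s) (-X') t := HasDerivAt.neg hX

theorem HasDerivAt.matrix_comp_const_sub {X : ℝ → Matrix m m ℝ} {X' : Matrix m m ℝ} {c t : ℝ}
    (hX : HasDerivAt X X' (c - t)) : HasDerivAt (fun s => X (c - s)) (-X') t :=
  HasDerivAt.comp_const_sub c t hX

theorem HasDerivAt.smul_const_matrix {c : ℝ → ℝ} {c' t : ℝ} (hc : HasDerivAt c c' t)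
    (X : Matrix m m ℝ) : HasDerivAt (fun s => c s • X) (c' • X) t := HasDerivAt.smul_const hc X

theorem HasDerivAt.matrix_continuousAt {X : ℝ → Matrix m m ℝ} {X' : Matrix m m ℝ} {t : ℝ}
    (hX : HasDerivAt X X' t) : ContinuousAt X t := HasDerivAt.continuousAt hX

theorem HasDerivAt.matrix_apply {X : ℝ → Matrix m m ℝ} {X' : Matrix m m ℝ} {t : ℝ}
    (hX : HasDerivAt X X' t) (i j : m) : HasDerivAt (fun s => X s i j) (X' i j) t :=
  (Matrix.entryLinearMap ℝ ℝ i j).hasDerivAt_comp hX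

theorem HasDerivAt.matrix_quad {X : ℝ → Matrix m m ℝ} {X' : Matrix m m ℝ}
    {t : ℝ} (hX : HasDerivAt X X' t) (x y : m → ℝ) :
    HasDerivAt (fun s => x ⬝ᵥ (X s *ᵥ y)) (x ⬝ᵥ (X' *ᵥ y)) t := (quadAt x y).hasDerivAt_comp hX

end MatrixCalculus

/-! ### Exponentials of Hamiltonian matrices are symplectic. -/

section Symplectic

variable {m : Type*} [Fintype m] [DecidableEq m]

theorem hamiltonian_transpose (A : Matrix m m ℝ) {N M : Matrix m m ℝ} (hN : N.IsSymm)
    (hM : M.IsSymm) : (fromBlocks A N M (-Aᵀ))ᵀ =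
      J m ℝ * (-fromBlocks A N M (-Aᵀ)) * (J m ℝ)⁻¹ := by
  rw [J_inv, Matrix.J]
  simp [fromBlocks_transpose, fromBlocks_multiply, fromBlocks_neg, hN.eq, hM.eq]

/-- Exponentiating the conjugation gives `exp(H)ᵀ = J exp(H)⁻¹ J⁻¹`, which is the symplectic
relation. -/
theorem exp_mem_symplecticGroup {H : Matrix (m ⊕ m) (m ⊕ m) ℝ}
    (hH : Hᵀ = J m ℝ * (-H) * (J m ℝ)⁻¹) : NormedSpace.exp H ∈ symplecticGroup m ℝ := by
  rw [SymplecticGroup.mem_iff']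
  have hJ : IsUnit (J m ℝ) := (Matrix.isUnit_iff_isUnit_det _).2 (isUnit_det_J m ℝ)
  have hi : (J m ℝ)⁻¹ * J m ℝ = 1 := Matrix.nonsing_inv_mul _ (isUnit_det_J m ℝ)
  have he : (NormedSpace.exp H)⁻¹ * NormedSpace.exp H = 1 :=
    Matrix.nonsing_inv_mul _ ((Matrix.isUnit_iff_isUnit_det _).1 (Matrix.isUnit_exp H))
  rw [← Matrix.exp_transpose, hH, Matrix.exp_conj _ _ hJ, Matrix.mul_assoc _ _ (J m ℝ), hi,
    Matrix.mul_one, Matrix.mul_assoc, Matrix.exp_neg, he, Matrix.mul_one]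

theorem exp_neg_smul_mem_symplecticGroup (A : Matrix m m ℝ) {N M : Matrix m m ℝ} (hN : N.IsSymm)
    (hM : M.IsSymm) (τ : ℝ) :
    NormedSpace.exp (-(τ • fromBlocks A N M (-Aᵀ))) ∈ symplecticGroup m ℝ := by
  apply exp_mem_symplecticGroup
  rw [transpose_neg, transpose_smul, hamiltonian_transpose A hN hM]
  simp only [Matrix.mul_neg, Matrix.neg_mul, Matrix.mul_smul, Matrix.smul_mul, smul_neg]

/-- The Schur complement of an invertible upper left block `a` of a symplectic matrix is `a⁻ᵀ`. -/
theorem fromBlocks_schur_of_mem_symplecticGroup {a b c d : Matrix m m ℝ}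
    (h : fromBlocks a b c d ∈ symplecticGroup m ℝ) (ha : IsUnit a) :
    d - c * a⁻¹ * b = (a⁻¹)ᵀ := by
  rw [SymplecticGroup.mem_iff', Matrix.J] at h
  simp only [fromBlocks_transpose, fromBlocks_multiply, Matrix.mul_zero, Matrix.mul_one, zero_add,
    Matrix.mul_neg, add_zero, Matrix.neg_mul, fromBlocks_inj] at h
  obtain ⟨h1, h2, -, -⟩ := h
  have had : IsUnit a.det := (Matrix.isUnit_iff_isUnit_det _).1 ha
  have h1' : aᵀ * c = cᵀ * a := by
    have := eq_neg_of_add_eq_zero_right h1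
    simpa using this
  have hat : IsUnit (aᵀ).det := by simpa using had
  have e1 : c * a⁻¹ = (aᵀ)⁻¹ * cᵀ := by
    rw [← Matrix.mul_one cᵀ, ← Matrix.mul_nonsing_inv a had, ← Matrix.mul_assoc cᵀ, ← h1',
      Matrix.mul_assoc, Matrix.nonsing_inv_mul_cancel_left _ _ hat]
  have e2 : d = (aᵀ)⁻¹ * (1 + cᵀ * b) := by
    have : aᵀ * d = 1 + cᵀ * b := by
      have h3 : -(aᵀ * d) = -1 - cᵀ * b := by rw [← h2]; abel
      rw [← neg_inj, h3]; abel
    rw [← this, Matrix.nonsing_inv_mul_cancel_left _ _ hat]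
  rw [e1, e2, Matrix.mul_add, Matrix.mul_assoc, Matrix.mul_one, add_sub_cancel_right,
    Matrix.transpose_nonsing_inv]

end Symplectic

/-! ### Solving the Riccati equation through the linear Hamiltonian flow. -/

section Riccati

variable {m : Type*} [Fintype m]

theorem hasDerivAt_toBlocks {F : ℝ → Matrix (m ⊕ m) (m ⊕ m) ℝ} {A N M : Matrix m m ℝ} {τ : ℝ}
    (hF : HasDerivAt F (-fromBlocks A N M (-Aᵀ) * F τ) τ) :
    HasDerivAt (fun τ => (F τ).toBlocks₁₁)
        (-(A * (F τ).toBlocks₁₁ + N * (F τ).toBlocks₂₁)) τ ∧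
      HasDerivAt (fun τ => (F τ).toBlocks₁₂)
        (-(A * (F τ).toBlocks₁₂ + N * (F τ).toBlocks₂₂)) τ ∧
      HasDerivAt (fun τ => (F τ).toBlocks₂₁)
        (-(M * (F τ).toBlocks₁₁ - Aᵀ * (F τ).toBlocks₂₁)) τ ∧
      HasDerivAt (fun τ => (F τ).toBlocks₂₂)
        (-(M * (F τ).toBlocks₁₂ - Aᵀ * (F τ).toBlocks₂₂)) τ := by
  have e : -fromBlocks A N M (-Aᵀ) * F τ = fromBlocks
      (-(A * (F τ).toBlocks₁₁ + N * (F τ).toBlocks₂₁))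
      (-(A * (F τ).toBlocks₁₂ + N * (F τ).toBlocks₂₂))
      (-(M * (F τ).toBlocks₁₁ - Aᵀ * (F τ).toBlocks₂₁))
      (-(M * (F τ).toBlocks₁₂ - Aᵀ * (F τ).toBlocks₂₂)) := by
    conv_lhs => rw [← fromBlocks_toBlocks (F τ)]
    rw [fromBlocks_neg, fromBlocks_multiply]
    congr 1 <;> simp only [Matrix.neg_mul, neg_neg] <;> abel
  rw [e] at hF
  exact ⟨(blockMap Sum.inl Sum.inl).hasDerivAt_matrix hF,
    (blockMap Sum.inl Sum.inr).hasDerivAt_matrix hF,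
    (blockMap Sum.inr Sum.inl).hasDerivAt_matrix hF,
    (blockMap Sum.inr Sum.inr).hasDerivAt_matrix hF⟩

variable [DecidableEq m] {F : ℝ → Matrix (m ⊕ m) (m ⊕ m) ℝ} {A N M P : Matrix m m ℝ} {h τ : ℝ}

theorem schur_of_mem_symplecticGroup {B : Matrix (m ⊕ m) (m ⊕ m) ℝ}
    (hB : B ∈ symplecticGroup m ℝ) (hu : IsUnit B.toBlocks₁₁) :
    B.toBlocks₂₂ - B.toBlocks₂₁ * B.toBlocks₁₁⁻¹ * B.toBlocks₁₂ = (B.toBlocks₁₁⁻¹)ᵀ := by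
  rw [← fromBlocks_toBlocks B] at hB
  exact fromBlocks_schur_of_mem_symplecticGroup hB hu

/-- The terms in `A` cancel and `a⁻¹ N (d - c a⁻¹ b)` remains; the Schur complement is `a⁻ᵀ`. The
congruence form of the derivative makes it positive semidefinite with `N`. -/
theorem hasDerivAt_inv_toBlocks₁₁_mul (hF : HasDerivAt F (-fromBlocks A N M (-Aᵀ) * F τ) τ)
    (hs : F τ ∈ symplecticGroup m ℝ) (hu : IsUnit (F τ).toBlocks₁₁) :
    HasDerivAt (fun τ => -((F τ).toBlocks₁₁⁻¹ * (F τ).toBlocks₁₂))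
      ((F τ).toBlocks₁₁⁻¹ * N * ((F τ).toBlocks₁₁⁻¹)ᵀ) τ := by
  obtain ⟨h1, h2, -, -⟩ := hasDerivAt_toBlocks hF
  have had := (Matrix.isUnit_iff_isUnit_det _).1 hu
  have hd := ((h1.matrix_inv hu).matrix_mul h2).matrix_neg
  convert hd using 1
  rw [← schur_of_mem_symplecticGroup hs hu]
  generalize (F τ).toBlocks₁₁ = a at *
  generalize (F τ).toBlocks₁₂ = b at *
  generalize (F τ).toBlocks₂₁ = c at *
  generalize (F τ).toBlocks₂₂ = d at *
  simp only [Matrix.mul_neg, Matrix.neg_mul, neg_neg, Matrix.mul_add, Matrix.add_mul,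
    Matrix.mul_sub, Matrix.mul_assoc, neg_add]
  rw [Matrix.mul_nonsing_inv_cancel_left _ _ had]
  abel

/-- `-F₁₁⁻¹ F₁₂` is nondecreasing as long as `F₁₁` is invertible. -/
theorem quad_inv_toBlocks₁₁_mul_le (hF : ∀ τ, HasDerivAt F (-fromBlocks A N M (-Aᵀ) * F τ) τ)
    (hs : ∀ τ, F τ ∈ symplecticGroup m ℝ) (hN : N.PosSemidef)
    (hu : ∀ τ ∈ Set.Icc 0 h, IsUnit (F τ).toBlocks₁₁) (hτ : τ ∈ Set.Icc 0 h) (x : m → ℝ) :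
    x ⬝ᵥ (-((F τ).toBlocks₁₁⁻¹ * (F τ).toBlocks₁₂)) *ᵥ x ≤
      x ⬝ᵥ (-((F h).toBlocks₁₁⁻¹ * (F h).toBlocks₁₂)) *ᵥ x := by
  have hd := fun τ hτ =>
    (hasDerivAt_inv_toBlocks₁₁_mul (hF τ) (hs τ) (hu τ hτ)).matrix_quad x x
  have hmono : MonotoneOn
      (fun τ => x ⬝ᵥ (-((F τ).toBlocks₁₁⁻¹ * (F τ).toBlocks₁₂)) *ᵥ x) (Set.Icc 0 h) := by
    refine monotoneOn_of_hasDerivWithinAt_nonneg (convex_Icc 0 h)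
      (fun τ hτ => (hd τ hτ).continuousAt.continuousWithinAt)
      (fun τ hτ => (hd τ (interior_subset hτ)).hasDerivWithinAt) (fun τ _ => ?_)
    have := hN.dotProduct_mulVec_nonneg (((F τ).toBlocks₁₁⁻¹)ᵀ *ᵥ x)
    simpa [← Matrix.mulVec_mulVec, Matrix.dotProduct_mulVec, Matrix.mulVec_transpose] using this
  exact hmono hτ (Set.right_mem_Icc.2 (hτ.1.trans hτ.2)) hτ.2

/-- The backward solution of the Riccati equation with terminal value `P`, as a function of the
remaining time. -/
noncomputable def riccati (F : ℝ → Matrix (m ⊕ m) (m ⊕ m) ℝ) (P : Matrix m m ℝ) (τ : ℝ) :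
    Matrix m m ℝ :=
  ((F τ).toBlocks₂₁ + (F τ).toBlocks₂₂ * P) * ((F τ).toBlocks₁₁ + (F τ).toBlocks₁₂ * P)⁻¹

/-- Rules out finite escape of the Riccati solution. A kernel vector `x` satisfies `-F₁₁⁻¹F₁₂ P x =
x` at time `τ`; by monotonicity in `τ` this contradicts the strict bound `hP` at `h`. -/
theorem isUnit_toBlocks₁₁_add (hF : ∀ τ, HasDerivAt F (-fromBlocks A N M (-Aᵀ) * F τ) τ)
    (hs : ∀ τ, F τ ∈ symplecticGroup m ℝ) (hN : N.PosSemidef)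
    (hu : ∀ τ ∈ Set.Icc 0 h, IsUnit (F τ).toBlocks₁₁)
    (hP : ∀ x ≠ 0, (P *ᵥ x) ⬝ᵥ (-((F h).toBlocks₁₁⁻¹ * (F h).toBlocks₁₂)) *ᵥ (P *ᵥ x) <
      x ⬝ᵥ P *ᵥ x) (hτ : τ ∈ Set.Icc 0 h) :
    IsUnit ((F τ).toBlocks₁₁ + (F τ).toBlocks₁₂ * P) := by
  rw [Matrix.isUnit_iff_isUnit_det, isUnit_iff_ne_zero]
  intro h0
  obtain ⟨x, hx, hx0⟩ := Matrix.exists_mulVec_eq_zero_iff.2 h0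
  have had := (Matrix.isUnit_iff_isUnit_det _).1 (hu τ hτ)
  have hle := quad_inv_toBlocks₁₁_mul_le hF hs hN hu hτ (P *ᵥ x)
  have hxe : (-((F τ).toBlocks₁₁⁻¹ * (F τ).toBlocks₁₂)) *ᵥ (P *ᵥ x) = x := by
    have h1 : (F τ).toBlocks₁₂ *ᵥ (P *ᵥ x) = -((F τ).toBlocks₁₁ *ᵥ x) := by
      rw [Matrix.add_mulVec, ← Matrix.mulVec_mulVec] at hx0
      exact eq_neg_of_add_eq_zero_right hx0
    rw [Matrix.neg_mulVec, ← Matrix.mulVec_mulVec, h1, Matrix.mulVec_neg, neg_neg,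
      Matrix.mulVec_mulVec, Matrix.nonsing_inv_mul _ had, Matrix.one_mulVec]
  rw [hxe, dotProduct_comm] at hle
  exact absurd (hP x hx) (not_lt.2 hle)

/-- Radon's substitution: `X' = -(AX + NY)` and `Y' = -(MX - AᵀY)`, so the quotient `Y X⁻¹`
satisfies the quadratic equation. -/
theorem hasDerivAt_riccati (hF : HasDerivAt F (-fromBlocks A N M (-Aᵀ) * F τ) τ)
    (hX : IsUnit ((F τ).toBlocks₁₁ + (F τ).toBlocks₁₂ * P)) :
    HasDerivAt (riccati F P) (-M + Aᵀ * riccati F P τ + riccati F P τ * A +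
      riccati F P τ * N * riccati F P τ) τ := by
  obtain ⟨h1, h2, h3, h4⟩ := hasDerivAt_toBlocks hF
  have hXd := (Matrix.isUnit_iff_isUnit_det _).1 hX
  have hd := (h3.matrix_add (h4.matrix_mul_const P)).matrix_mul
    ((h1.matrix_add (h2.matrix_mul_const P)).matrix_inv hX)
  refine Eq.mp (congrArg (fun D => HasDerivAt (riccati F P) D τ) ?_) hd
  have ex : -(A * (F τ).toBlocks₁₁ + N * (F τ).toBlocks₂₁) +
      -(A * (F τ).toBlocks₁₂ + N * (F τ).toBlocks₂₂) * P =
      -(A * ((F τ).toBlocks₁₁ + (F τ).toBlocks₁₂ * P) +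
        N * ((F τ).toBlocks₂₁ + (F τ).toBlocks₂₂ * P)) := by
    simp only [Matrix.mul_add, Matrix.add_mul, Matrix.neg_mul, Matrix.mul_assoc]
    abel
  have ey : -(M * (F τ).toBlocks₁₁ - Aᵀ * (F τ).toBlocks₂₁) +
      -(M * (F τ).toBlocks₁₂ - Aᵀ * (F τ).toBlocks₂₂) * P =
      -(M * ((F τ).toBlocks₁₁ + (F τ).toBlocks₁₂ * P) -
        Aᵀ * ((F τ).toBlocks₂₁ + (F τ).toBlocks₂₂ * P)) := by
    simp only [Matrix.mul_add, Matrix.sub_mul, Matrix.neg_mul, Matrix.mul_assoc]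
    abel
  rw [ex, ey, riccati]
  generalize (F τ).toBlocks₁₁ + (F τ).toBlocks₁₂ * P = X at *
  generalize (F τ).toBlocks₂₁ + (F τ).toBlocks₂₂ * P = Y at *
  simp only [Matrix.mul_neg, Matrix.neg_mul, neg_neg, Matrix.mul_add, Matrix.add_mul,
    Matrix.sub_mul, Matrix.mul_assoc, Matrix.mul_nonsing_inv _ hXd, Matrix.mul_one,
    neg_sub]
  abel

/-- The graph of a symmetric `P` is Lagrangian and `F` preserves such subspaces: `XᵀY = YᵀX`, which
is symmetry of `Y X⁻¹`. -/
theorem riccati_isSymm (hs : F τ ∈ symplecticGroup m ℝ) (hP : P.IsSymm)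
    (hX : IsUnit ((F τ).toBlocks₁₁ + (F τ).toBlocks₁₂ * P)) : (riccati F P τ).IsSymm := by
  have hXd := (Matrix.isUnit_iff_isUnit_det _).1 hX
  rw [SymplecticGroup.mem_iff', ← fromBlocks_toBlocks (F τ), Matrix.J] at hs
  simp only [fromBlocks_transpose, fromBlocks_multiply, Matrix.mul_zero, Matrix.mul_one, zero_add,
    Matrix.mul_neg, add_zero, Matrix.neg_mul, fromBlocks_inj] at hs
  unfold riccati
  generalize (F τ).toBlocks₁₁ = a at *
  generalize (F τ).toBlocks₁₂ = b at *
  generalize (F τ).toBlocks₂₁ = c at *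
  generalize (F τ).toBlocks₂₂ = d at *
  obtain ⟨h1, h2, h3, h4⟩ := hs
  have key : (a + b * P)ᵀ * (c + d * P) = (c + d * P)ᵀ * (a + b * P) := by
    have e1 : cᵀ * a = aᵀ * c := by simpa [add_neg_eq_zero] using h1
    have e2 : cᵀ * b = aᵀ * d - 1 := by rw [eq_sub_of_add_eq h2]; abel
    have e3 : dᵀ * a = bᵀ * c + 1 := by rw [← h3]; abel
    have e4 : dᵀ * b = bᵀ * d := by simpa [add_neg_eq_zero] using h4
    have e5 : (c + d * P)ᵀ * (a + b * P) =
        cᵀ * a + (cᵀ * b) * P + P * (dᵀ * a) + P * (dᵀ * b) * P := by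
      simp only [Matrix.transpose_add, Matrix.transpose_mul, hP.eq, Matrix.mul_add, Matrix.add_mul,
        Matrix.mul_assoc]
      abel
    rw [e5, e1, e2, e3, e4]
    simp only [Matrix.transpose_add, Matrix.transpose_mul, hP.eq, Matrix.mul_add, Matrix.add_mul,
      Matrix.mul_assoc, Matrix.sub_mul, Matrix.one_mul, Matrix.mul_one]
    abel
  have hXt : IsUnit ((a + b * P)ᵀ).det := by rwa [Matrix.det_transpose]
  rw [Matrix.IsSymm, Matrix.transpose_mul, Matrix.transpose_nonsing_inv]
  generalize a + b * P = X at *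
  generalize c + d * P = Y at *
  rw [← Matrix.mul_one Yᵀ, ← Matrix.mul_nonsing_inv X hXd, ← Matrix.mul_assoc Yᵀ, ← key,
    Matrix.mul_assoc, Matrix.nonsing_inv_mul_cancel_left _ _ hXt]

theorem riccati_zero (h0 : F 0 = 1) : riccati F P 0 = P := by
  rw [riccati, h0, ← fromBlocks_one, toBlocks_fromBlocks₁₁, toBlocks_fromBlocks₁₂,
    toBlocks_fromBlocks₂₁, toBlocks_fromBlocks₂₂]
  simp

/-- The Riccati solution, expressed through the blocks occurring in the matrix inequality. -/
theorem riccati_eq (hs : F τ ∈ symplecticGroup m ℝ) (hu : IsUnit (F τ).toBlocks₁₁)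
    (hX : IsUnit ((F τ).toBlocks₁₁ + (F τ).toBlocks₁₂ * P)) :
    IsUnit (1 - -((F τ).toBlocks₁₁⁻¹ * (F τ).toBlocks₁₂) * P) ∧
    riccati F P τ = (F τ).toBlocks₂₁ * (F τ).toBlocks₁₁⁻¹ +
      ((F τ).toBlocks₁₁⁻¹)ᵀ * (P *
        (1 - -((F τ).toBlocks₁₁⁻¹ * (F τ).toBlocks₁₂) * P)⁻¹ * (F τ).toBlocks₁₁⁻¹) := by
  have hsch := schur_of_mem_symplecticGroup hs hu
  have had := (Matrix.isUnit_iff_isUnit_det _).1 hu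
  unfold riccati
  generalize (F τ).toBlocks₁₁ = a at *
  generalize (F τ).toBlocks₁₂ = b at *
  generalize (F τ).toBlocks₂₁ = c at *
  generalize (F τ).toBlocks₂₂ = d at *
  have hU : a + b * P = a * (1 - -(a⁻¹ * b) * P) := by
    rw [Matrix.mul_sub, Matrix.neg_mul, Matrix.mul_neg, Matrix.mul_assoc,
      Matrix.mul_nonsing_inv_cancel_left _ _ had, Matrix.mul_one, sub_neg_eq_add]
  have hUu : IsUnit (1 - -(a⁻¹ * b) * P) := by
    rw [hU] at hX
    exact (hu.mul_left_iff).1 hX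
  refine ⟨hUu, ?_⟩
  have hUd := (Matrix.isUnit_iff_isUnit_det _).1 hUu
  -- Substituting `d = c a⁻¹ b + a⁻ᵀ` splits `Y` into a multiple of `U = 1 + a⁻¹ b P` and `a⁻ᵀ P`,
  -- while `X = a U`.
  have hY : c + d * P = c * (1 - -(a⁻¹ * b) * P) + (a⁻¹)ᵀ * P := by
    rw [← hsch]
    simp only [Matrix.mul_sub, Matrix.sub_mul, Matrix.neg_mul, Matrix.mul_neg, Matrix.mul_one,
      Matrix.mul_assoc]
    abel
  rw [hU, hY, Matrix.mul_inv_rev, Matrix.add_mul, Matrix.mul_assoc c,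
    Matrix.mul_nonsing_inv_cancel_left _ _ hUd]
  simp only [Matrix.mul_assoc]

end Riccati

/-! ### The supply in state and input variables, and completion of squares. -/

theorem dotProduct_transpose_mulVec_eq {a b : Type*} [Fintype a] [Fintype b] (M : Matrix a b ℝ)
    (x : b → ℝ) (y : a → ℝ) : x ⬝ᵥ (Mᵀ *ᵥ y) = (M *ᵥ x) ⬝ᵥ y := by
  rw [Matrix.dotProduct_mulVec, Matrix.vecMul_transpose]

theorem Matrix.IsSymm.dotProduct_mulVec_comm {a : Type*} [Fintype a] {M : Matrix a a ℝ}
    (hM : M.IsSymm) (x y : a → ℝ) : x ⬝ᵥ (M *ᵥ y) = y ⬝ᵥ (M *ᵥ x) := by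
  rw [Matrix.dotProduct_mulVec, ← Matrix.mulVec_transpose, hM.eq, dotProduct_comm]

theorem quadSupply_eq {a b : ℕ} (Q : Matrix (Fin a) (Fin a) ℝ) (S : Matrix (Fin a) (Fin b) ℝ)
    (R : Matrix (Fin b) (Fin b) ℝ) (w : Fin a → ℝ) (z : Fin b → ℝ) :
    quadSupply Q S R w z = w ⬝ᵥ (Q *ᵥ w) + 2 * (w ⬝ᵥ (S *ᵥ z)) + z ⬝ᵥ (R *ᵥ z) := by
  rw [quadSupply, fromBlocks_mulVec, sumElim_dotProduct_sumElim]
  simp only [Sum.elim_comp_inl, Sum.elim_comp_inr, dotProduct_add, dotProduct_transpose_mulVec_eq]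
  rw [dotProduct_comm (S *ᵥ z) w]
  ring

namespace LPJF

variable {n wc wd zc zd : ℕ} (T : LPJF n wc wd zc zd)

/-- The flow supply in the variables `(ξ, w_c)`. -/
theorem quadSupply_flow {Qc : Matrix (Fin wc) (Fin wc) ℝ} {Sc : Matrix (Fin wc) (Fin zc) ℝ}
    {Rc : Matrix (Fin zc) (Fin zc) ℝ} (hRc : Rc.IsSymm) (x : Fin n → ℝ) (w : Fin wc → ℝ) :
    quadSupply Qc Sc Rc w (T.Cc *ᵥ x + T.Dc *ᵥ w) =
      x ⬝ᵥ (T.M₁ Rc *ᵥ x) + 2 * (w ⬝ᵥ ((T.M₃ Sc Rc)ᵀ *ᵥ x)) + w ⬝ᵥ (T.M₂ Qc Sc Rc *ᵥ w) := by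
  rw [quadSupply_eq, M₁, M₂, M₃]
  simp only [Matrix.transpose_add, Matrix.transpose_mul, Matrix.transpose_transpose, hRc.eq,
    Matrix.add_mulVec, ← Matrix.mulVec_mulVec, dotProduct_add, Matrix.mulVec_add,
    dotProduct_transpose_mulVec_eq, add_dotProduct]
  rw [hRc.dotProduct_mulVec_comm (T.Cc *ᵥ x) (T.Dc *ᵥ w), dotProduct_comm (Sc *ᵥ _) w]
  ring

theorem M₁_isSymm {Rc : Matrix (Fin zc) (Fin zc) ℝ} (hRc : Rc.IsSymm) : (T.M₁ Rc).IsSymm := by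
  simp [Matrix.IsSymm, M₁, hRc.eq, Matrix.mul_assoc]

/-- Completion of squares: the Riccati equation yields the dissipation inequality along flows. -/
theorem flow_dissipation {Qc : Matrix (Fin wc) (Fin wc) ℝ} {Sc : Matrix (Fin wc) (Fin zc) ℝ}
    {Rc : Matrix (Fin zc) (Fin zc) ℝ} (hRc : Rc.IsSymm) (hM₂ : (T.M₂ Qc Sc Rc).PosDef)
    {K A N M : Matrix (Fin n) (Fin n) ℝ} (hK : K.IsSymm)
    (hA : A = T.Ac - T.Bc * (T.M₂ Qc Sc Rc)⁻¹ * (T.M₃ Sc Rc)ᵀ)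
    (hN : N = T.Bc * (T.M₂ Qc Sc Rc)⁻¹ * T.Bcᵀ)
    (hM : M = T.M₁ Rc - T.M₃ Sc Rc * (T.M₂ Qc Sc Rc)⁻¹ * (T.M₃ Sc Rc)ᵀ)
    (x : Fin n → ℝ) (w : Fin wc → ℝ) :
    (T.Ac *ᵥ x + T.Bc *ᵥ w) ⬝ᵥ (K *ᵥ x) + x ⬝ᵥ (K *ᵥ (T.Ac *ᵥ x + T.Bc *ᵥ w)) +
        x ⬝ᵥ (-(-M + Aᵀ * K + K * A + K * N * K) *ᵥ x) ≤
      quadSupply Qc Sc Rc w (T.Cc *ᵥ x + T.Dc *ᵥ w) := by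
  rw [T.quadSupply_flow hRc]
  have hdet := (Matrix.isUnit_iff_isUnit_det _).1 hM₂.isUnit
  have hsymm : (T.M₂ Qc Sc Rc).IsSymm := by
    have := hM₂.isHermitian
    rwa [Matrix.IsHermitian, conjTranspose_eq_transpose_of_trivial] at this
  have hpos := hM₂.posSemidef.dotProduct_mulVec_nonneg
  generalize T.M₂ Qc Sc Rc = M2 at *
  generalize T.M₃ Sc Rc = M3 at *
  generalize T.M₁ Rc = M1 at *
  obtain ⟨a, ha⟩ : ∃ a, a = M2⁻¹ *ᵥ (T.Bcᵀ *ᵥ (K *ᵥ x)) := ⟨_, rfl⟩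
  obtain ⟨b, hb⟩ : ∃ b, b = M2⁻¹ *ᵥ (M3ᵀ *ᵥ x) := ⟨_, rfl⟩
  have ha' : T.Bcᵀ *ᵥ (K *ᵥ x) = M2 *ᵥ a := by
    rw [ha, Matrix.mulVec_mulVec _ M2, Matrix.mul_nonsing_inv _ hdet, Matrix.one_mulVec]
  have hb' : M3ᵀ *ᵥ x = M2 *ᵥ b := by
    rw [hb, Matrix.mulVec_mulVec _ M2, Matrix.mul_nonsing_inv _ hdet, Matrix.one_mulVec]
  have eA : A *ᵥ x = T.Ac *ᵥ x - T.Bc *ᵥ b := by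
    rw [hA, Matrix.sub_mulVec, ← Matrix.mulVec_mulVec, ← Matrix.mulVec_mulVec, hb]
  have eN : N *ᵥ (K *ᵥ x) = T.Bc *ᵥ a := by
    rw [hN, ← Matrix.mulVec_mulVec, ← Matrix.mulVec_mulVec, ha]
  have eM : M *ᵥ x = M1 *ᵥ x - M3 *ᵥ b := by
    rw [hM, Matrix.sub_mulVec, ← Matrix.mulVec_mulVec, ← Matrix.mulVec_mulVec, hb]
  have hB : ∀ y, (K *ᵥ x) ⬝ᵥ (T.Bc *ᵥ y) = y ⬝ᵥ (M2 *ᵥ a) := fun y => by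
    rw [← ha', dotProduct_transpose_mulVec_eq, dotProduct_comm]
  have h3 : x ⬝ᵥ (M3 *ᵥ b) = b ⬝ᵥ (M2 *ᵥ b) := by
    rw [← hb', dotProduct_transpose_mulVec_eq, dotProduct_comm]
  have hKx : ∀ y, x ⬝ᵥ (K *ᵥ y) = (K *ᵥ x) ⬝ᵥ y := fun y => by
    rw [hK.dotProduct_mulVec_comm, dotProduct_comm]
  -- `a - b = M₂⁻¹(BcᵀKx - M₃ᵀx)` is the worst disturbance: the supply minus the left side is
  -- exactly the `M₂`-form of `w - (a - b)`.
  have h := hpos (w - (a - b))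
  simp only [star_trivial, Matrix.mulVec_sub, dotProduct_sub, sub_dotProduct] at h
  rw [hsymm.dotProduct_mulVec_comm a w, hsymm.dotProduct_mulVec_comm b w,
    hsymm.dotProduct_mulVec_comm b a] at h
  simp only [Matrix.neg_mulVec, Matrix.add_mulVec, ← Matrix.mulVec_mulVec, dotProduct_neg,
    dotProduct_add, dotProduct_transpose_mulVec_eq, eA, eN, eM, hb', hKx, dotProduct_sub,
    sub_dotProduct, add_dotProduct, h3, hB]
  rw [dotProduct_comm (T.Ac *ᵥ x), dotProduct_comm (T.Bc *ᵥ w), dotProduct_comm (T.Bc *ᵥ b), hB,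
    hB, hsymm.dotProduct_mulVec_comm b a]
  linarith

end LPJF

/-- The constant is the minimum of the form on the compact unit sphere, carried to all vectors by
homogeneity. -/
theorem exists_mul_dotProduct_le_quad {m : Type*} [Fintype m] (M : Matrix m m ℝ) :
    ∃ c, (∀ x : m → ℝ, c * (x ⬝ᵥ x) ≤ x ⬝ᵥ (M *ᵥ x)) ∧
      ((∀ x ≠ 0, 0 < x ⬝ᵥ (M *ᵥ x)) → 0 < c) := by
  let s : Set (m → ℝ) := {x | x ⬝ᵥ x = 1}
  have hs : IsCompact s := by
    refine Metric.isCompact_of_isClosed_isBounded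
      (isClosed_eq (by fun_prop) continuous_const) ?_
    refine (Metric.isBounded_closedBall (x := (0 : m → ℝ)) (r := 1)).subset fun x hx => ?_
    rw [mem_closedBall_zero_iff, pi_norm_le_iff_of_nonneg zero_le_one]
    intro i
    have h1 : x i * x i ≤ x ⬝ᵥ x :=
      Finset.single_le_sum (f := fun i => x i * x i) (fun j _ => mul_self_nonneg _)
        (Finset.mem_univ i)
    rw [show x ⬝ᵥ x = 1 from hx] at h1
    exact abs_le_one_iff_mul_self_le_one.2 h1
  have hq : Continuous fun x : m → ℝ => x ⬝ᵥ (M *ᵥ x) := by fun_prop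
  rcases s.eq_empty_or_nonempty with he | hne
  · have h0 : ∀ x : m → ℝ, x = 0 := by
      by_contra! ⟨x, hx⟩
      have hpos : 0 < x ⬝ᵥ x := by simpa using Matrix.dotProduct_star_self_pos_iff.2 hx
      have : (√(x ⬝ᵥ x))⁻¹ • x ∈ s := by
        change _ ⬝ᵥ _ = (1 : ℝ)
        rw [smul_dotProduct, dotProduct_smul, smul_smul, ← mul_inv, Real.mul_self_sqrt hpos.le,
          smul_eq_mul, inv_mul_cancel₀ hpos.ne']
      rw [he] at this
      exact this
    -- In dimension zero the sphere is empty and any positive constant serves.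
    exact ⟨1, fun x => by simp [h0 x], fun _ => one_pos⟩
  · obtain ⟨y, hy, hmin⟩ := hs.exists_isMinOn hne hq.continuousOn
    refine ⟨y ⬝ᵥ (M *ᵥ y), fun x => ?_, fun h => h y ?_⟩
    · by_cases hx : x = 0
      · simp [hx]
      have hpos : 0 < x ⬝ᵥ x := by simpa using Matrix.dotProduct_star_self_pos_iff.2 hx
      have hmem : (√(x ⬝ᵥ x))⁻¹ • x ∈ s := by
        change _ ⬝ᵥ _ = (1 : ℝ)
        rw [smul_dotProduct, dotProduct_smul, smul_smul, ← mul_inv, Real.mul_self_sqrt hpos.le,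
          smul_eq_mul, inv_mul_cancel₀ hpos.ne']
      have := isMinOn_iff.1 hmin _ hmem
      rw [Matrix.mulVec_smul, smul_dotProduct, dotProduct_smul, smul_smul, ← mul_inv,
        Real.mul_self_sqrt hpos.le, smul_eq_mul, inv_mul_eq_div, le_div_iff₀ hpos] at this
      exact this
    · rintro rfl
      simp [s] at hy

/-! ### The LMI as a quadratic form, and elimination of its auxiliary blocks. -/

theorem Matrix.PosDef.isSymm {a : Type*} [Fintype a] {M : Matrix a a ℝ} (hM : M.PosDef) :
    M.IsSymm := by
  have := hM.isHermitian
  rwa [Matrix.IsHermitian, conjTranspose_eq_transpose_of_trivial] at this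

theorem quad_fromBlocks {a b : Type*} [Fintype a] [Fintype b] (A : Matrix a a ℝ)
    (C : Matrix b a ℝ) (D : Matrix b b ℝ) (x : a → ℝ) (y : b → ℝ) :
    Sum.elim x y ⬝ᵥ (fromBlocks A Cᵀ C D *ᵥ Sum.elim x y) =
      x ⬝ᵥ (A *ᵥ x) + 2 * (y ⬝ᵥ (C *ᵥ x)) + y ⬝ᵥ (D *ᵥ y) := by
  rw [fromBlocks_mulVec, sumElim_dotProduct_sumElim]
  simp only [Sum.elim_comp_inl, Sum.elim_comp_inr, dotProduct_add, dotProduct_transpose_mulVec_eq]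
  rw [dotProduct_comm (C *ᵥ x) y]
  ring

theorem quad_fromBlocks_diag {a b : Type*} [Fintype a] [Fintype b] (A : Matrix a a ℝ)
    (D : Matrix b b ℝ) (x : a → ℝ) (y : b → ℝ) :
    Sum.elim x y ⬝ᵥ (fromBlocks A 0 0 D *ᵥ Sum.elim x y) = x ⬝ᵥ (A *ᵥ x) + y ⬝ᵥ (D *ᵥ y) := by
  simpa using quad_fromBlocks A 0 D x y

namespace LPJF

variable {n wc wd zc zd e r q : ℕ} (T : LPJF n wc wd zc zd)

theorem quad_lmi (Qd : Matrix (Fin wd) (Fin wd) ℝ) (Sd : Matrix (Fin wd) (Fin zd) ℝ)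
    (Ed : Matrix (Fin e) (Fin zd) ℝ) (Pd : Matrix (Fin e) (Fin e) ℝ)
    (Ah : Matrix (Fin n) (Fin n) ℝ) (Bh : Matrix (Fin n) (Fin q) ℝ)
    (Ch : Matrix (Fin r) (Fin n) ℝ) (P : Matrix (Fin n) (Fin n) ℝ)
    (x : Fin n → ℝ) (v : Fin wd → ℝ) (p : Fin e → ℝ) (c : Fin r → ℝ) (a : Fin n → ℝ)
    (b : Fin q → ℝ) :
    Sum.elim (Sum.elim x v) (Sum.elim p (Sum.elim c (Sum.elim a b))) ⬝ᵥ
        (T.lmi Qd Sd Ed Pd Ah Bh Ch P *ᵥ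
          Sum.elim (Sum.elim x v) (Sum.elim p (Sum.elim c (Sum.elim a b)))) =
      x ⬝ᵥ (P *ᵥ x) +
        (v ⬝ᵥ (Qd *ᵥ v) + 2 * (v ⬝ᵥ (Sd *ᵥ (T.Cd *ᵥ x + T.Dd *ᵥ v)))) +
        (2 * (p ⬝ᵥ (Ed *ᵥ (T.Cd *ᵥ x + T.Dd *ᵥ v))) + p ⬝ᵥ (Pd *ᵥ p)) +
        (2 * (c ⬝ᵥ (Ch *ᵥ (T.Ad *ᵥ x + T.Bd *ᵥ v))) + c ⬝ᵥ c) +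
        (2 * (a ⬝ᵥ (P *ᵥ (Ah *ᵥ (T.Ad *ᵥ x + T.Bd *ᵥ v)))) + a ⬝ᵥ (P *ᵥ a) +
          2 * (b ⬝ᵥ (Bhᵀ *ᵥ (P *ᵥ a))) + b ⬝ᵥ b) := by
  simp only [lmi, quad_fromBlocks_diag, quad_fromBlocks, fromRows_mulVec, fromCols_mulVec,
    Sum.elim_comp_inl, Sum.elim_comp_inr, sumElim_dotProduct_sumElim, Matrix.zero_mulVec,
    dotProduct_zero, Matrix.one_mulVec, Matrix.add_mulVec, Matrix.mulVec_add, ← Matrix.mulVec_mulVec,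
    dotProduct_add]
  rw [dotProduct_transpose_mulVec_eq T.Dd, dotProduct_comm (T.Dd *ᵥ v),
    ← dotProduct_transpose_mulVec_eq Sdᵀ, Matrix.transpose_transpose]
  ring

/-- The value of the matrix inequality at the vector that eliminates its last four blocks. -/
theorem exists_quad_lmi_eq {Qd : Matrix (Fin wd) (Fin wd) ℝ} {Sd : Matrix (Fin wd) (Fin zd) ℝ}
    {Rd : Matrix (Fin zd) (Fin zd) ℝ}
    {Ed : Matrix (Fin e) (Fin zd) ℝ} {Pd : Matrix (Fin e) (Fin e) ℝ}
    {Ah : Matrix (Fin n) (Fin n) ℝ} {Bh : Matrix (Fin n) (Fin q) ℝ}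
    {Ch : Matrix (Fin r) (Fin n) ℝ} {P : Matrix (Fin n) (Fin n) ℝ}
    (hPd : Pd.PosDef) (hRd : Rd = -(Edᵀ * Pd⁻¹ * Ed)) (hP : P.IsSymm)
    (hU : IsUnit (1 - Bh * Bhᵀ * P)) (x : Fin n → ℝ) (v : Fin wd → ℝ) :
    ∃ u, Sum.elim (Sum.elim x v) u ⬝ᵥ
        (T.lmi Qd Sd Ed Pd Ah Bh Ch P *ᵥ Sum.elim (Sum.elim x v) u) =
      x ⬝ᵥ (P *ᵥ x) + quadSupply Qd Sd Rd v (T.Cd *ᵥ x + T.Dd *ᵥ v) -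
        (T.Ad *ᵥ x + T.Bd *ᵥ v) ⬝ᵥ
          ((Chᵀ * Ch + Ahᵀ * (P * (1 - Bh * Bhᵀ * P)⁻¹ * Ah)) *ᵥ (T.Ad *ᵥ x + T.Bd *ᵥ v)) := by
  set z := T.Cd *ᵥ x + T.Dd *ᵥ v with hz
  set y := T.Ad *ᵥ x + T.Bd *ᵥ v with hy
  have hPdd := (Matrix.isUnit_iff_isUnit_det _).1 hPd.isUnit
  have hUd := (Matrix.isUnit_iff_isUnit_det _).1 hU
  obtain ⟨a, ha⟩ : ∃ a, a = (1 - Bh * Bhᵀ * P)⁻¹ *ᵥ (Ah *ᵥ y) := ⟨_, rfl⟩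
  have ha' : Ah *ᵥ y = a - Bh *ᵥ (Bhᵀ *ᵥ (P *ᵥ a)) := by
    have : (1 - Bh * Bhᵀ * P) *ᵥ a = Ah *ᵥ y := by
      rw [ha, Matrix.mulVec_mulVec _ (1 - Bh * Bhᵀ * P), Matrix.mul_nonsing_inv _ hUd,
        Matrix.one_mulVec]
    rw [← this, Matrix.sub_mulVec, Matrix.one_mulVec, ← Matrix.mulVec_mulVec,
      ← Matrix.mulVec_mulVec]
  -- The stationary point of the form in its last four blocks; for the last two, the equations are
  -- `b = -BhᵀP a'` and `(1 - BhBhᵀP) a' = -Ah y`, whence `a' = -a`.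
  refine ⟨Sum.elim (-(Pd⁻¹ *ᵥ (Ed *ᵥ z))) (Sum.elim (-(Ch *ᵥ y))
    (Sum.elim (-a) (Bhᵀ *ᵥ (P *ᵥ a)))), ?_⟩
  rw [quad_lmi, quadSupply_eq, hRd, ← hz, ← hy]
  have e1 : Pd *ᵥ (Pd⁻¹ *ᵥ (Ed *ᵥ z)) = Ed *ᵥ z := by
    rw [Matrix.mulVec_mulVec _ Pd, Matrix.mul_nonsing_inv _ hPdd, Matrix.one_mulVec]
  have e2 : (P * (1 - Bh * Bhᵀ * P)⁻¹ * Ah) *ᵥ y = P *ᵥ a := by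
    rw [← Matrix.mulVec_mulVec, ← Matrix.mulVec_mulVec, ha]
  have e3 : a ⬝ᵥ (P *ᵥ (Bh *ᵥ (Bhᵀ *ᵥ (P *ᵥ a)))) =
      (Bhᵀ *ᵥ (P *ᵥ a)) ⬝ᵥ (Bhᵀ *ᵥ (P *ᵥ a)) := by
    rw [hP.dotProduct_mulVec_comm, dotProduct_comm, ← dotProduct_transpose_mulVec_eq Bhᵀ,
      Matrix.transpose_transpose]
  have e4 : (Bh *ᵥ (Bhᵀ *ᵥ (P *ᵥ a))) ⬝ᵥ (P *ᵥ a) =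
      (Bhᵀ *ᵥ (P *ᵥ a)) ⬝ᵥ (Bhᵀ *ᵥ (P *ᵥ a)) := by
    rw [← dotProduct_transpose_mulVec_eq]
  simp only [Matrix.mulVec_neg, neg_dotProduct, dotProduct_neg, neg_neg, e1, Matrix.neg_mulVec,
    Matrix.add_mulVec, dotProduct_add, ha', Matrix.mulVec_sub, dotProduct_sub, e3,
    ← Matrix.mulVec_mulVec (M := Edᵀ * Pd⁻¹), ← Matrix.mulVec_mulVec (M := Edᵀ),
    ← Matrix.mulVec_mulVec (M := Chᵀ), ← Matrix.mulVec_mulVec (M := Ahᵀ), e2,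
    dotProduct_transpose_mulVec_eq Ed, dotProduct_transpose_mulVec_eq Ch,
    dotProduct_transpose_mulVec_eq Ah, sub_dotProduct, e4]
  rw [dotProduct_comm (Ed *ᵥ z)]
  ring

theorem lmi_posDef {Qd : Matrix (Fin wd) (Fin wd) ℝ} {Sd : Matrix (Fin wd) (Fin zd) ℝ}
    {Ed : Matrix (Fin e) (Fin zd) ℝ} {Pd : Matrix (Fin e) (Fin e) ℝ}
    {Ah : Matrix (Fin n) (Fin n) ℝ} {Bh : Matrix (Fin n) (Fin q) ℝ}
    {Ch : Matrix (Fin r) (Fin n) ℝ} {P : Matrix (Fin n) (Fin n) ℝ}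
    (hL : (T.lmi Qd Sd Ed Pd Ah Bh Ch P).PosDef) :
    P.PosDef := by
  have := hL.submatrix (e := fun i : Fin n => Sum.inl (Sum.inl i))
    (Sum.inl_injective.comp Sum.inl_injective)
  exact this

/-- The Schur complement `P - P Bh Bhᵀ P ≻ 0` of blocks 5 and 6, obtained by setting all other
blocks to zero. -/
theorem lmi_quad_lt {Qd : Matrix (Fin wd) (Fin wd) ℝ} {Sd : Matrix (Fin wd) (Fin zd) ℝ}
    {Ed : Matrix (Fin e) (Fin zd) ℝ} {Pd : Matrix (Fin e) (Fin e) ℝ}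
    {Ah : Matrix (Fin n) (Fin n) ℝ} {Bh : Matrix (Fin n) (Fin q) ℝ}
    {Ch : Matrix (Fin r) (Fin n) ℝ} {P : Matrix (Fin n) (Fin n) ℝ}
    (hL : (T.lmi Qd Sd Ed Pd Ah Bh Ch P).PosDef) (x : Fin n → ℝ) (hx : x ≠ 0) :
    (P *ᵥ x) ⬝ᵥ ((Bh * Bhᵀ) *ᵥ (P *ᵥ x)) < x ⬝ᵥ (P *ᵥ x) := by
  have hne : Sum.elim (Sum.elim (0 : Fin n → ℝ) (0 : Fin wd → ℝ)) (Sum.elim (0 : Fin e → ℝ)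
      (Sum.elim (0 : Fin r → ℝ) (Sum.elim x (-(Bhᵀ *ᵥ (P *ᵥ x)))))) ≠ 0 := fun h =>
    hx (funext fun i => congrFun h (Sum.inr (Sum.inr (Sum.inr (Sum.inl i)))))
  have h := hL.dotProduct_mulVec_pos hne
  rw [star_trivial, quad_lmi] at h
  simp only [Matrix.mulVec_zero, dotProduct_zero, add_zero, zero_add, mul_zero,
    neg_dotProduct, dotProduct_neg, neg_neg] at h
  rw [← Matrix.mulVec_mulVec, ← Matrix.transpose_transpose Bh, dotProduct_transpose_mulVec_eq,
    Matrix.transpose_transpose]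
  linarith

end LPJF

/-! ### Absolutely continuous functions and integrated differential inequalities. -/

theorem AbsolutelyContinuousOnInterval.fun_finset_sum {ι : Type*} (s : Finset ι) {f : ι → ℝ → ℝ}
    {a b : ℝ} (hf : ∀ i ∈ s, AbsolutelyContinuousOnInterval (f i) a b) :
    AbsolutelyContinuousOnInterval (fun t => ∑ i ∈ s, f i t) a b := by
  classical
  induction s using Finset.induction_on with
  | empty =>
    simp only [Finset.sum_empty]
    exact ((LipschitzWith.const (0 : ℝ)).lipschitzOnWith).absolutelyContinuousOnInterval
  | insert i s hi ih =>
    simp only [Finset.sum_insert hi]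
    exact (hf i (Finset.mem_insert_self i s)).fun_add
      (ih fun j hj => hf j (Finset.mem_insert_of_mem hj))

theorem absolutelyContinuousOnInterval_of_hasDerivAt {g g' : ℝ → ℝ} {a b : ℝ} (hab : a ≤ b)
    (hg : ∀ t ∈ Set.Icc a b, HasDerivAt g (g' t) t) (hc : ContinuousOn g' (Set.Icc a b)) :
    AbsolutelyContinuousOnInterval g a b := by
  obtain ⟨C, hC⟩ := isCompact_Icc.exists_bound_of_continuousOn hc
  have hL : LipschitzOnWith C.toNNReal g (Set.Icc a b) :=
    (convex_Icc a b).lipschitzOnWith_of_nnnorm_hasDerivWithin_le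
      (fun t ht => (hg t ht).hasDerivWithinAt) fun t ht => by
        rw [← NNReal.coe_le_coe, coe_nnnorm]
        exact (hC t ht).trans (Real.le_coe_toNNReal C)
  rw [← Set.uIcc_of_le hab] at hL
  exact hL.absolutelyContinuousOnInterval

theorem AbsolutelyContinuousOnInterval.sub_le_integral {V s : ℝ → ℝ} {a b : ℝ} (hab : a ≤ b)
    (hV : AbsolutelyContinuousOnInterval V a b) (hs : IntervalIntegrable s volume a b)
    (hle : ∀ᵐ t, t ∈ Set.Icc a b → deriv V t ≤ s t) : V b - V a ≤ ∫ t in a..b, s t := by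
  rw [← hV.integral_deriv_eq_sub]
  refine intervalIntegral.integral_mono_ae_restrict hab hV.intervalIntegrable_deriv hs ?_
  exact (ae_restrict_iff' measurableSet_Icc).2 hle

/-- Along an absolutely continuous curve `η` with velocity `f`, a time-varying quadratic form grows
at most by the integral of any upper bound of its formal derivative. -/
theorem quad_sub_le_integral {m : Type*} [Fintype m] {a b : ℝ} (hab : a ≤ b) {f η : ℝ → m → ℝ}
    (hf : IntervalIntegrable f volume a b)
    (hη : ∀ t ∈ Set.Icc a b, η t = η a + ∫ r in a..t, f r) {K K' : ℝ → Matrix m m ℝ}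
    (hK : ∀ t ∈ Set.Icc a b, HasDerivAt K (K' t) t) (hK' : ContinuousOn K' (Set.Icc a b))
    {s : ℝ → ℝ} (hs : IntervalIntegrable s volume a b)
    (hle : ∀ t ∈ Set.Icc a b,
      f t ⬝ᵥ (K t *ᵥ η t) + η t ⬝ᵥ (K t *ᵥ f t) + η t ⬝ᵥ (K' t *ᵥ η t) ≤ s t) :
    η b ⬝ᵥ (K b *ᵥ η b) - η a ⬝ᵥ (K a *ᵥ η a) ≤ ∫ t in a..b, s t := by
  -- `η` is controlled only on `[a, b]`; its integral formula `g` is defined on all of `ℝ`, so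
  -- two-sided derivatives can be taken.
  let g : m → ℝ → ℝ := fun i t => η a i + ∫ r in a..t, f r i
  have hfi : ∀ i, IntervalIntegrable (fun r => f r i) volume a b := fun i =>
    ⟨(ContinuousLinearMap.proj (R := ℝ) (φ := fun _ : m => ℝ) i).integrable_comp hf.1,
      (ContinuousLinearMap.proj (R := ℝ) (φ := fun _ : m => ℝ) i).integrable_comp hf.2⟩
  have hgη : ∀ t ∈ Set.Icc a b, ∀ i, g i t = η t i := by
    intro t ht i
    have hft : IntervalIntegrable f volume a t :=
      hf.mono_set (by
        rw [Set.uIcc_of_le ht.1, Set.uIcc_of_le hab]; exact Set.Icc_subset_Icc_right ht.2)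
    have := (ContinuousLinearMap.proj (R := ℝ) (φ := fun _ : m => ℝ) i).intervalIntegral_comp_comm
      hft
    rw [hη t ht]
    simp only [ContinuousLinearMap.proj_apply] at this
    simp only [g, this, Pi.add_apply]
  have hgac : ∀ i, AbsolutelyContinuousOnInterval (g i) a b := fun i =>
    (((LipschitzWith.const (η a i)).lipschitzOnWith).absolutelyContinuousOnInterval).fun_add
      ((hfi i).absolutelyContinuousOnInterval_intervalIntegral Set.left_mem_uIcc)
  have hKac : ∀ i j, AbsolutelyContinuousOnInterval (fun t => K t i j) a b := fun i j =>
    absolutelyContinuousOnInterval_of_hasDerivAt hab (fun t ht => (hK t ht).matrix_apply i j)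
      ((continuous_apply_apply i j).comp_continuousOn hK')
  have hVac : AbsolutelyContinuousOnInterval
      (fun t => ∑ i, ∑ j, g i t * (K t i j * g j t)) a b :=
    .fun_finset_sum _ fun i _ => .fun_finset_sum _ fun j _ =>
      (hgac i).fun_mul ((hKac i j).fun_mul (hgac j))
  have hV : ∀ t ∈ Set.Icc a b,
      ∑ i, ∑ j, g i t * (K t i j * g j t) = η t ⬝ᵥ (K t *ᵥ η t) := fun t ht => by
    simp only [hgη t ht, dotProduct, Matrix.mulVec, Finset.mul_sum]
  have hmain := hVac.sub_le_integral hab hs (by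
    have hall : ∀ᵐ t, ∀ i, t ∈ Set.uIcc a b → ∀ c ∈ Set.uIcc a b,
        HasDerivAt (fun x => ∫ r in c..x, f r i) (f t i) t :=
      ae_all_iff.2 fun i => (hfi i).ae_hasDerivAt_integral
    filter_upwards [hall] with t ht htI
    have hgd : ∀ i, HasDerivAt (g i) (f t i) t := fun i =>
      (ht i (by rwa [Set.uIcc_of_le hab]) a Set.left_mem_uIcc).const_add (η a i)
    have hd : HasDerivAt (fun t => ∑ i, ∑ j, g i t * (K t i j * g j t))
        (∑ i, ∑ j, (f t i * (K t i j * g j t) +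
          g i t * (K' t i j * g j t + K t i j * f t j))) t :=
      HasDerivAt.fun_sum fun i _ => HasDerivAt.fun_sum fun j _ =>
        (hgd i).mul (((hK t htI).matrix_apply i j).mul (hgd j))
    rw [hd.deriv]
    refine le_of_eq_of_le ?_ (hle t htI)
    simp only [hgη t htI, dotProduct, Matrix.mulVec, Finset.mul_sum, ← Finset.sum_add_distrib]
    refine Finset.sum_congr rfl fun i _ => Finset.sum_congr rfl fun j _ => ?_
    ring)
  simp only [hV b (Set.right_mem_Icc.2 hab), hV a (Set.left_mem_Icc.2 hab)] at hmain
  exact hmain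

/-- Almost everywhere `(η, w)` stays in a product of two closed balls, which is compact, so `φ` is
bounded there. -/
theorem intervalIntegrable_comp_of_memLp_top {m p : Type*} [Fintype m] [Fintype p] {G : Type*}
    [NormedAddCommGroup G] {φ : (m → ℝ) × (p → ℝ) → G} (hφ : Continuous φ) {a b : ℝ} (hab : a ≤ b)
    {η : ℝ → m → ℝ} (hη : ContinuousOn η (Set.Icc a b)) {w : ℝ → p → ℝ}
    (hw : MemLp w ⊤ (volume.restrict (Set.Icc a b))) :
    IntervalIntegrable (fun t => φ (η t, w t)) volume a b := by
  rw [intervalIntegrable_iff_integrableOn_Icc_of_le hab]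
  obtain ⟨C, hC⟩ := isCompact_Icc.exists_bound_of_continuousOn hη
  set D := (eLpNormEssSup w (volume.restrict (Set.Icc a b))).toReal
  have hfin : eLpNormEssSup w (volume.restrict (Set.Icc a b)) < ⊤ := by
    rw [← eLpNorm_exponent_top]; exact hw.2
  have hD : ∀ᵐ t ∂volume.restrict (Set.Icc a b), ‖w t‖ ≤ D := by
    filter_upwards [enorm_ae_le_eLpNormEssSup w (volume.restrict (Set.Icc a b))] with t ht
    rw [← toReal_enorm]
    exact ENNReal.toReal_mono hfin.ne ht
  obtain ⟨B, hB⟩ := ((isCompact_closedBall (0 : m → ℝ) C).prod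
    (isCompact_closedBall (0 : p → ℝ) D)).exists_bound_of_continuousOn hφ.continuousOn
  refine Integrable.of_bound (C := B)
    (hφ.comp_aestronglyMeasurable ((hη.aestronglyMeasurable measurableSet_Icc).prodMk hw.1)) ?_
  filter_upwards [hD, ae_restrict_mem measurableSet_Icc] with t h1 h2
  exact hB _ ⟨mem_closedBall_zero_iff.2 (hC t h2), mem_closedBall_zero_iff.2 h1⟩

/-! ### Trajectories within one sampling period. -/

namespace LPJF

variable {n wc wd zc zd : ℕ} {T : LPJF n wc wd zc zd} {h t₀ t₁ : ℝ} {ξ : ℝ → Fin n → ℝ}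
  {w : ℝ → Fin wc → ℝ} {v : ℕ → Fin wd → ℝ}

theorem IsSolutionOn.mono (hs : T.IsSolutionOn h t₀ t₁ ξ w v) {a b : ℝ} (ha : t₀ ≤ a)
    (hb : b ≤ t₁) : T.IsSolutionOn h a b ξ w v where
  input := hs.input.mono_measure (Measure.restrict_mono (Set.Icc_subset_Icc ha hb) le_rfl)
  flow k s t h1 h2 h3 h4 h5 := hs.flow k s t h1 h2 h3 (ha.trans h4) (h5.trans hb)
  jump k h1 h2 := hs.jump k (ha.trans h1) (h2.trans_le hb)

/-- `η` is a continuous solution of the flow equation on the closed interval `[a, b]`. -/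
structure IsFlowOn (T : LPJF n wc wd zc zd) (a b : ℝ) (η : ℝ → Fin n → ℝ)
    (w : ℝ → Fin wc → ℝ) : Prop where
  input : MemLp w ⊤ (volume.restrict (Set.Icc a b))
  integrable : IntervalIntegrable (fun r => T.Ac *ᵥ η r + T.Bc *ᵥ w r) volume a b
  eq : ∀ t ∈ Set.Icc a b, η t = η a + ∫ r in a..t, (T.Ac *ᵥ η r + T.Bc *ᵥ w r)

theorem IsFlowOn.continuousOn {a b : ℝ} {η : ℝ → Fin n → ℝ} (hab : a ≤ b)
    (hf : T.IsFlowOn a b η w) : ContinuousOn η (Set.Icc a b) := by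
  have h1 : ContinuousOn
      (fun t => η a + ∫ r in a..t, (T.Ac *ᵥ η r + T.Bc *ᵥ w r)) (Set.Icc a b) := by
    refine continuousOn_const.add ?_
    have := intervalIntegral.continuousOn_primitive_interval' hf.integrable Set.left_mem_uIcc
    rwa [Set.uIcc_of_le hab] at this
  exact h1.congr hf.eq

theorem IsSolutionOn.isFlowOn (hs : T.IsSolutionOn h t₀ t₁ ξ w v) {k : ℕ} (h₀ : k * h < t₀)
    (h₀₁ : t₀ ≤ t₁) (h₁ : t₁ ≤ (k + 1) * h) : T.IsFlowOn t₀ t₁ ξ w where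
  input := hs.input
  integrable := (hs.flow k t₀ t₁ h₀ h₀₁ h₁ le_rfl le_rfl).1
  eq t ht := (hs.flow k t₀ t h₀ ht.1 (ht.2.trans h₁) le_rfl ht.2).2

/-- Resetting the state at a jump time to its value after the jump yields a continuous solution of
the flow equation on the closed interval up to the next jump. -/
theorem IsSolutionOn.isFlowOn_update {k : ℕ} (hs : T.IsSolutionOn h (k * h) t₁ ξ w v)
    (h₀₁ : k * h < t₁) (h₁ : t₁ ≤ (k + 1) * h) :
    T.IsFlowOn (k * h) t₁
      (Function.update ξ (k * h) (T.Ad *ᵥ ξ (k * h) + T.Bd *ᵥ v k)) w := by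
  set a : ℝ := k * h with ha
  set η := Function.update ξ a (T.Ad *ᵥ ξ a + T.Bd *ᵥ v k) with hη
  have hηξ : ∀ t, t ≠ a → η t = ξ t := fun t ht => Function.update_of_ne ht _ _
  -- The flow equation is available only strictly after the jump, so each `t` is treated on a window
  -- starting at the midpoint of `a` and `t`.
  have hξc : ContinuousOn ξ (Set.Ioc a t₁) := by
    intro t ht
    have hm : a < (a + t) / 2 := by linarith [ht.1]
    have hf := (hs.mono hm.le le_rfl).isFlowOn hm (by linarith [ht.1, ht.2]) h₁
    have hc := hf.continuousOn (by linarith [ht.1, ht.2]) t ⟨by linarith [ht.1], ht.2⟩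
    refine hc.mono_of_mem_nhdsWithin ?_
    filter_upwards [self_mem_nhdsWithin,
      mem_nhdsWithin_of_mem_nhds (Ici_mem_nhds (show (a + t) / 2 < t by linarith [ht.1]))]
      with r h1 h2
    exact ⟨h2, h1.2⟩
  have hηc : ContinuousOn η (Set.Icc a t₁) := by
    rw [hη, continuousOn_update_iff]
    have e : Set.Icc a t₁ \ {a} = Set.Ioc a t₁ := Set.Icc_sdiff_left
    rw [e]
    exact ⟨hξc, fun _ => (hs.jump k le_rfl h₀₁).mono_left (nhdsWithin_mono _ fun t ht => ht.1)⟩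
  have hφ : Continuous fun p : (Fin n → ℝ) × (Fin wc → ℝ) => T.Ac *ᵥ p.1 + T.Bc *ᵥ p.2 := by
    fun_prop
  have hint : IntervalIntegrable (fun r => T.Ac *ᵥ η r + T.Bc *ᵥ w r) volume a t₁ :=
    intervalIntegrable_comp_of_memLp_top hφ h₀₁.le hηc hs.input
  refine ⟨hs.input, hint, fun t ht => ?_⟩
  rcases ht.1.eq_or_lt with rfl | hat
  · simp
  have hprim := intervalIntegral.continuousOn_primitive_interval' hint Set.left_mem_uIcc
  rw [Set.uIcc_of_le h₀₁.le] at hprim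
  -- `η` minus its primitive is constant on `(a, t]`; letting `s` decrease to `a` carries the
  -- integral equation to the jump time.
  have hsub : ∀ s ∈ Set.Ioc a t, η t - ∫ r in a..t, (T.Ac *ᵥ η r + T.Bc *ᵥ w r) =
      η s - ∫ r in a..s, (T.Ac *ᵥ η r + T.Bc *ᵥ w r) := by
    intro s hsI
    have h2 := (hs.flow k s t hsI.1 hsI.2 (ht.2.trans h₁) hsI.1.le ht.2).2
    have h3 : ∫ r in s..t, (T.Ac *ᵥ ξ r + T.Bc *ᵥ w r) =
        ∫ r in s..t, (T.Ac *ᵥ η r + T.Bc *ᵥ w r) := by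
      refine intervalIntegral.integral_congr fun r hr => ?_
      rw [Set.uIcc_of_le hsI.2] at hr
      simp only [hηξ r (hsI.1.trans_le hr.1).ne']
    have hi : ∀ c d, a ≤ c → c ≤ d → d ≤ t₁ →
        IntervalIntegrable (fun r => T.Ac *ᵥ η r + T.Bc *ᵥ w r) volume c d :=
      fun c d hc hcd hd => hint.mono_set (by
        rw [Set.uIcc_of_le hcd, Set.uIcc_of_le h₀₁.le]; exact Set.Icc_subset_Icc hc hd)
    have h4 := intervalIntegral.integral_add_adjacent_intervals
      (hi a s le_rfl hsI.1.le (hsI.2.trans ht.2)) (hi s t hsI.1.le hsI.2 ht.2)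
    rw [hηξ t hat.ne', hηξ s hsI.1.ne', h2, h3, ← h4]
    abel
  have ht1 : Tendsto (fun s => η s - ∫ r in a..s, (T.Ac *ᵥ η r + T.Bc *ᵥ w r))
      (𝓝[Set.Ioc a t] a) (𝓝 (η a - ∫ r in a..a, (T.Ac *ᵥ η r + T.Bc *ᵥ w r))) :=
    ((hηc.sub hprim) a (Set.left_mem_Icc.2 h₀₁.le)).mono_left
      (nhdsWithin_mono _ fun s hs => ⟨hs.1.le, hs.2.trans ht.2⟩)
  have ht2 : Tendsto (fun s => η s - ∫ r in a..s, (T.Ac *ᵥ η r + T.Bc *ᵥ w r))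
      (𝓝[Set.Ioc a t] a) (𝓝 (η t - ∫ r in a..t, (T.Ac *ᵥ η r + T.Bc *ᵥ w r))) :=
    tendsto_const_nhds.congr' (eventually_nhdsWithin_of_forall hsub)
  have hne : (𝓝[Set.Ioc a t] a).NeBot := by
    rw [nhdsWithin_Ioc_eq_nhdsGT hat]; infer_instance
  have := tendsto_nhds_unique ht1 ht2
  rw [intervalIntegral.integral_same, sub_zero] at this
  rw [this]
  abel

/-- A certificate on flow windows: a matrix function of the remaining time whose quadratic form
grows at most at the rate `sc`. -/
theorem IsFlowOn.quad_sub_le {a b c : ℝ} {η : ℝ → Fin n → ℝ} (hf : T.IsFlowOn a b η w)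
    (hab : a ≤ b) (hac : c - a ≤ h) (hbc : b ≤ c)
    {sc : (Fin wc → ℝ) → (Fin zc → ℝ) → ℝ} (hsc : Continuous (Function.uncurry sc))
    {K K' : ℝ → Matrix (Fin n) (Fin n) ℝ} (hK : ∀ r ∈ Set.Icc 0 h, HasDerivAt K (K' r) r)
    (hK' : ContinuousOn K' (Set.Icc 0 h))
    (hle : ∀ r ∈ Set.Icc 0 h, ∀ x t, (T.Ac *ᵥ x + T.Bc *ᵥ w t) ⬝ᵥ (K r *ᵥ x) +
      x ⬝ᵥ (K r *ᵥ (T.Ac *ᵥ x + T.Bc *ᵥ w t)) + x ⬝ᵥ (-(K' r) *ᵥ x) ≤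
        sc (w t) (T.Cc *ᵥ x + T.Dc *ᵥ w t)) :
    IntervalIntegrable (fun t => sc (w t) (T.Cc *ᵥ η t + T.Dc *ᵥ w t)) volume a b ∧
      η b ⬝ᵥ (K (c - b) *ᵥ η b) - η a ⬝ᵥ (K (c - a) *ᵥ η a) ≤
        ∫ t in a..b, sc (w t) (T.Cc *ᵥ η t + T.Dc *ᵥ w t) := by
  have hφ : Continuous fun p : (Fin n → ℝ) × (Fin wc → ℝ) =>
      sc p.2 (T.Cc *ᵥ p.1 + T.Dc *ᵥ p.2) :=
    hsc.comp (continuous_snd.prodMk (by fun_prop))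
  have hint := intervalIntegrable_comp_of_memLp_top hφ hab (hf.continuousOn hab) hf.input
  have hmem : ∀ t ∈ Set.Icc a b, c - t ∈ Set.Icc 0 h := fun t ht =>
    ⟨by linarith [ht.2], by linarith [ht.1]⟩
  refine ⟨hint, quad_sub_le_integral (K := fun t => K (c - t)) (K' := fun t => -K' (c - t)) hab
    hf.integrable hf.eq (fun t ht => ?_) ?_ hint fun t ht => hle _ (hmem t ht) _ _⟩
  · exact (hK _ (hmem t ht)).matrix_comp_const_sub
  · exact (hK'.comp (by fun_prop) hmem).neg

end LPJF

/-! ### From a certificate to dissipativity and exponential stability. -/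

namespace LPJF

variable {n wc wd zc zd : ℕ} {T : LPJF n wc wd zc zd} {h : ℝ} {ξ : ℝ → Fin n → ℝ}
  {w : ℝ → Fin wc → ℝ} {v : ℕ → Fin wd → ℝ}

/-- The dissipation inequality with storage function `S` along one trajectory on `[a, b]`. -/
def DissipatesOn (T : LPJF n wc wd zc zd) (h : ℝ) (sc : (Fin wc → ℝ) → (Fin zc → ℝ) → ℝ)
    (sd : (Fin wd → ℝ) → (Fin zd → ℝ) → ℝ) (S : (Fin n → ℝ) → ℝ → ℝ) (ξ : ℝ → Fin n → ℝ)
    (w : ℝ → Fin wc → ℝ) (v : ℕ → Fin wd → ℝ) (a b : ℝ) : Prop :=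
  IntervalIntegrable (fun t => sc (w t) (T.Cc *ᵥ ξ t + T.Dc *ᵥ w t)) volume a b ∧
    S (ξ b) b ≤ S (ξ a) a + (∫ t in a..b, sc (w t) (T.Cc *ᵥ ξ t + T.Dc *ᵥ w t)) +
      ∑ k ∈ Finset.Ico ⌈a / h⌉₊ ⌈b / h⌉₊, sd (v k) (T.Cd *ᵥ ξ (k * h) + T.Dd *ᵥ v k)

variable {sc : (Fin wc → ℝ) → (Fin zc → ℝ) → ℝ} {sd : (Fin wd → ℝ) → (Fin zd → ℝ) → ℝ}
  {S : (Fin n → ℝ) → ℝ → ℝ}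

theorem DissipatesOn.trans (hh : 0 < h) {a b c : ℝ} (hab : a ≤ b) (hbc : b ≤ c)
    (h₁ : T.DissipatesOn h sc sd S ξ w v a b) (h₂ : T.DissipatesOn h sc sd S ξ w v b c) :
    T.DissipatesOn h sc sd S ξ w v a c := by
  refine ⟨h₁.1.trans h₂.1, ?_⟩
  rw [← intervalIntegral.integral_add_adjacent_intervals h₁.1 h₂.1,
    ← Finset.sum_Ico_consecutive _ (Nat.ceil_mono (div_le_div_of_nonneg_right hab hh.le))
      (Nat.ceil_mono (div_le_div_of_nonneg_right hbc hh.le))]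
  linarith [h₁.2, h₂.2]

theorem dissipatesOn_refl (a : ℝ) : T.DissipatesOn h sc sd S ξ w v a a :=
  ⟨IntervalIntegrable.refl, by simp⟩

theorem ceil_div_eq (hh : 0 < h) {k : ℕ} {t : ℝ} (h₁ : k * h < t) (h₂ : t ≤ (k + 1) * h) :
    ⌈t / h⌉₊ = k + 1 := by
  rw [Nat.ceil_eq_iff (Nat.succ_ne_zero k)]
  refine ⟨?_, ?_⟩
  · rw [lt_div_iff₀ hh]; simpa using h₁
  · rw [div_le_iff₀ hh]; simpa using h₂

theorem ceil_mul_div (hh : 0 < h) (k : ℕ) : ⌈k * h / h⌉₊ = k := by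
  rw [mul_div_cancel_right₀ _ hh.ne', Nat.ceil_natCast]

/-- The dissipation inequality on windows within one sampling period implies it on all windows. -/
theorem dissipatesOn_of_periods (hh : 0 < h)
    (h₁ : ∀ (k : ℕ) (a b : ℝ), k * h < a → a ≤ b → b ≤ (k + 1) * h →
      T.IsSolutionOn h a b ξ w v → T.DissipatesOn h sc sd S ξ w v a b)
    (h₂ : ∀ (k : ℕ) (b : ℝ), k * h < b → b ≤ (k + 1) * h →
      T.IsSolutionOn h (k * h) b ξ w v → T.DissipatesOn h sc sd S ξ w v (k * h) b)
    {a b : ℝ} (ha : 0 ≤ a) (hab : a ≤ b) (hs : T.IsSolutionOn h a b ξ w v) :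
    T.DissipatesOn h sc sd S ξ w v a b := by
  obtain ⟨N, hN⟩ : ∃ N : ℕ, b ≤ N * h :=
    ⟨⌈b / h⌉₊, (div_le_iff₀ hh).1 (Nat.le_ceil _)⟩
  induction N generalizing a b with
  | zero =>
    obtain rfl : a = b := by
      apply le_antisymm hab
      simpa using hN.trans (by simpa using ha)
    exact dissipatesOn_refl a
  | succ N ih =>
    push_cast at hN
    rcases le_or_gt b (N * h) with hb | hb
    · exact ih ha hab hs hb
    rcases le_or_gt a (N * h) with ha' | ha'
    · exact (ih ha ha' (hs.mono le_rfl hb.le) le_rfl).trans hh ha' hb.le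
        (h₂ N b hb hN (hs.mono ha' le_rfl))
    · exact h₁ N a b ha' hab hN hs

variable {K K' : ℝ → Matrix (Fin n) (Fin n) ℝ}

/-- A Riccati-type certificate for the flow together with a jump inequality yields dissipativity,
the storage function being the quadratic form of the certificate at the remaining time. -/
theorem dissipative_of_certificate (hh : 0 < h) (hsc : Continuous (Function.uncurry sc))
    (hK : ∀ r ∈ Set.Icc 0 h, HasDerivAt K (K' r) r) (hK' : ContinuousOn K' (Set.Icc 0 h))
    (hflow : ∀ r ∈ Set.Icc 0 h, ∀ x u, (T.Ac *ᵥ x + T.Bc *ᵥ u) ⬝ᵥ (K r *ᵥ x) +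
      x ⬝ᵥ (K r *ᵥ (T.Ac *ᵥ x + T.Bc *ᵥ u)) + x ⬝ᵥ (-(K' r) *ᵥ x) ≤
        sc u (T.Cc *ᵥ x + T.Dc *ᵥ u))
    (hjump : ∀ x u, (T.Ad *ᵥ x + T.Bd *ᵥ u) ⬝ᵥ (K h *ᵥ (T.Ad *ᵥ x + T.Bd *ᵥ u)) ≤
      x ⬝ᵥ (K 0 *ᵥ x) + sd u (T.Cd *ᵥ x + T.Dd *ᵥ u)) :
    T.Dissipative h sc sd := by
  -- `⌈t / h⌉₊ * h - t` vanishes at a jump time and tends to `h` just after it: `K 0` weighs the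
  -- state before the jump, `K h` the state after.
  refine ⟨fun x t => x ⬝ᵥ (K (⌈t / h⌉₊ * h - t) *ᵥ x), fun t₀ t₁ h0 h01 ξ w v hs => ?_⟩
  refine dissipatesOn_of_periods (S := fun x t => x ⬝ᵥ (K (⌈t / h⌉₊ * h - t) *ᵥ x)) hh
    (fun k a b ha hab hb hs => ?_) (fun k b hkb hb hs => ?_) h0 h01 hs
  · obtain ⟨hint, hle⟩ := (hs.isFlowOn ha hab hb).quad_sub_le hab
      (by linarith : (k + 1) * h - a ≤ h) hb hsc hK hK' fun r hr x t => hflow r hr x (w t)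
    refine ⟨hint, ?_⟩
    beta_reduce
    rw [ceil_div_eq hh ha (hab.trans hb), ceil_div_eq hh (ha.trans_le hab) hb]
    push_cast
    simp only [Finset.Ico_self, Finset.sum_empty]
    linarith
  · obtain ⟨hint, hle⟩ := (hs.isFlowOn_update hkb hb).quad_sub_le hkb.le
      (by linarith : (k + 1) * h - k * h ≤ h) hb hsc hK hK' fun r hr x t => hflow r hr x (w t)
    -- The half-open interval omits `k h`, the only point where the reset state differs from `ξ`.
    have hae : ∀ t ∈ Set.uIoc (k * h) b,
        sc (w t) (T.Cc *ᵥ Function.update ξ (k * h) (T.Ad *ᵥ ξ (k * h) + T.Bd *ᵥ v k) t +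
          T.Dc *ᵥ w t) = sc (w t) (T.Cc *ᵥ ξ t + T.Dc *ᵥ w t) := fun t ht => by
      rw [Set.uIoc_of_le hkb.le] at ht
      rw [Function.update_of_ne ht.1.ne']
    refine ⟨hint.congr hae, ?_⟩
    beta_reduce
    rw [intervalIntegral.integral_congr_ae (.of_forall hae), Function.update_of_ne hkb.ne',
      Function.update_self, show ((k : ℝ) + 1) * h - k * h = h by ring] at hle
    rw [ceil_div_eq hh hkb hb, ceil_mul_div hh]
    push_cast
    simp only [Nat.Ico_succ_singleton, Finset.sum_singleton, sub_self]
    linarith [hjump (ξ (k * h)) (v k)]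

/-- Grönwall's inequality, as the certificate `K r = exp(lam r) • 1` with zero supply. -/
theorem IsFlowOn.dotProduct_le {a b lam : ℝ} {η : ℝ → Fin n → ℝ}
    (hf : T.IsFlowOn a b η (fun _ => 0)) (hab : a ≤ b) (hba : b - a ≤ h) (hlam : 0 ≤ lam)
    (hle : ∀ x : Fin n → ℝ, 2 * (x ⬝ᵥ (T.Ac *ᵥ x)) ≤ lam * (x ⬝ᵥ x)) :
    η b ⬝ᵥ η b ≤ Real.exp (lam * h) * (η a ⬝ᵥ η a) := by
  have hK : ∀ r, HasDerivAt (fun r => Real.exp (lam * r) • (1 : Matrix (Fin n) (Fin n) ℝ))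
      ((lam * Real.exp (lam * r)) • 1) r := fun r => by
    refine HasDerivAt.smul_const_matrix ?_ (1 : Matrix (Fin n) (Fin n) ℝ)
    simpa [mul_comm] using ((hasDerivAt_id r).const_mul lam).exp
  have := (hf.quad_sub_le (h := h) (sc := fun _ (_ : Fin zc → ℝ) => 0) hab hba le_rfl
    continuous_const (fun r _ => hK r) (by fun_prop) fun r _ x _ => by
      have := mul_le_mul_of_nonneg_left (hle x) (Real.exp_pos (lam * r)).le
      simp only [Matrix.mulVec_zero, add_zero, Matrix.smul_mulVec, Matrix.one_mulVec,
        dotProduct_smul, smul_eq_mul, Matrix.neg_mulVec, dotProduct_neg]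
      rw [dotProduct_comm (T.Ac *ᵥ x) x]
      linarith).2
  simp only [sub_self, mul_zero, Real.exp_zero, one_smul, Matrix.one_mulVec, Matrix.smul_mulVec,
    dotProduct_smul, smul_eq_mul, intervalIntegral.integral_zero] at this
  have h2 : Real.exp (lam * (b - a)) * (η a ⬝ᵥ η a) ≤ Real.exp (lam * h) * (η a ⬝ᵥ η a) :=
    mul_le_mul_of_nonneg_right (Real.exp_le_exp.2 (mul_le_mul_of_nonneg_left hba hlam))
      (Finset.sum_nonneg fun i _ => mul_self_nonneg _)
  linarith

theorem norm_toLp_sq (x : Fin n → ℝ) : ‖WithLp.toLp 2 x‖ ^ 2 = x ⬝ᵥ x := by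
  rw [EuclideanSpace.norm_sq_eq]
  simp [dotProduct, sq]

theorem exists_quad_le {m : Type*} [Fintype m] (M : Matrix m m ℝ) :
    ∃ c, 0 ≤ c ∧ ∀ x : m → ℝ, x ⬝ᵥ (M *ᵥ x) ≤ c * (x ⬝ᵥ x) := by
  obtain ⟨c, hc, -⟩ := exists_mul_dotProduct_le_quad (-M)
  refine ⟨|c|, abs_nonneg c, fun x => ?_⟩
  have h1 := hc x
  rw [Matrix.neg_mulVec, dotProduct_neg] at h1
  have h2 : 0 ≤ x ⬝ᵥ x := Finset.sum_nonneg fun i _ => mul_self_nonneg _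
  nlinarith [neg_abs_le c]

/-- Exponential decay at the jump times with uniformly bounded growth in between. -/
theorem ges_of_contraction (hh : 0 < h) {ρ C L : ℝ} (hρ : 0 < ρ) (hρ1 : ρ < 1) (hC : 0 ≤ C)
    (hL : 0 ≤ L)
    (H : ∀ ξ : ℝ → Fin n → ℝ,
      (∀ t₁ : ℝ, 0 ≤ t₁ → T.IsSolutionOn h 0 t₁ ξ (fun _ => 0) (fun _ => 0)) →
      (∀ k : ℕ, ξ (k * h) ⬝ᵥ ξ (k * h) ≤ C * ρ ^ k * (ξ 0 ⬝ᵥ ξ 0)) ∧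
      ∀ (k : ℕ) (t : ℝ), k * h < t → t ≤ (k + 1) * h →
        ξ t ⬝ᵥ ξ t ≤ L * (ξ (k * h) ⬝ᵥ ξ (k * h))) : T.GES h := by
  have hlog : Real.log ρ < 0 := Real.log_neg hρ hρ1
  -- The `1` covers `t = 0`. Division by `ρ` pays for `ρ ^ k = ρ ^ (k + 1) / ρ`, where `t / h ≤ k +
  -- 1`. The rate below has the factor `2` because squared norms are compared.
  have hc : 0 < 1 + L * C / ρ := by positivity
  have hα : 0 < -Real.log ρ / (2 * h) := div_pos (neg_pos.2 hlog) (by positivity)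
  refine ⟨√(1 + L * C / ρ), Real.sqrt_pos.2 hc, -Real.log ρ / (2 * h), hα, fun ξ hξ t ht => ?_⟩
  obtain ⟨h1, h2⟩ := H ξ hξ
  have hy : 0 ≤ ξ 0 ⬝ᵥ ξ 0 := Finset.sum_nonneg fun i _ => mul_self_nonneg _
  rw [← pow_le_pow_iff_left₀ (norm_nonneg _) (by positivity) two_ne_zero, mul_pow, mul_pow,
    norm_toLp_sq, norm_toLp_sq, Real.sq_sqrt hc.le, ← Real.exp_nat_mul]
  have hexp : ((2 : ℕ) : ℝ) * (-(-Real.log ρ / (2 * h)) * t) = Real.log ρ * (t / h) := by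
    push_cast; field_simp
  rw [hexp]
  rcases ht.eq_or_lt with rfl | ht0
  · simp only [zero_div, mul_zero, Real.exp_zero, mul_one]
    exact le_mul_of_one_le_left hy (by linarith [show 0 ≤ L * C / ρ by positivity])
  obtain ⟨k, hk⟩ : ∃ k, ⌈t / h⌉₊ = k + 1 :=
    Nat.exists_eq_succ_of_ne_zero (Nat.ceil_pos.2 (by positivity)).ne'
  obtain ⟨hk1, hk2⟩ := (Nat.ceil_eq_iff (Nat.succ_ne_zero k)).1 hk
  have hk1' : k * h < t := by rw [lt_div_iff₀ hh] at hk1; simpa using hk1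
  have hk2' : t / h ≤ k + 1 := by simpa using hk2
  have h3 := h2 k t hk1' ((div_le_iff₀ hh).1 hk2')
  have h4 : ρ ^ (k + 1) ≤ Real.exp (Real.log ρ * (t / h)) := by
    rw [← Real.exp_log (pow_pos hρ (k + 1)), Real.log_pow, Real.exp_le_exp]
    push_cast
    nlinarith
  calc ξ t ⬝ᵥ ξ t ≤ L * (C * ρ ^ k * (ξ 0 ⬝ᵥ ξ 0)) := h3.trans (by gcongr; exact h1 k)
    _ = L * C / ρ * ρ ^ (k + 1) * (ξ 0 ⬝ᵥ ξ 0) := by field_simp; ring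
    _ ≤ (1 + L * C / ρ) * Real.exp (Real.log ρ * (t / h)) * (ξ 0 ⬝ᵥ ξ 0) := by
      gcongr; linarith

/-- If the certificate strictly decreases at jumps and does not increase along free flows, the
origin is globally exponentially stable. -/
theorem ges_of_certificate (hh : 0 < h) (hsc : Continuous (Function.uncurry sc))
    (hsc0 : ∀ z, sc 0 z ≤ 0)
    (hK : ∀ r ∈ Set.Icc 0 h, HasDerivAt K (K' r) r) (hK' : ContinuousOn K' (Set.Icc 0 h))
    (hflow : ∀ r ∈ Set.Icc 0 h, ∀ x u, (T.Ac *ᵥ x + T.Bc *ᵥ u) ⬝ᵥ (K r *ᵥ x) +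
      x ⬝ᵥ (K r *ᵥ (T.Ac *ᵥ x + T.Bc *ᵥ u)) + x ⬝ᵥ (-(K' r) *ᵥ x) ≤
        sc u (T.Cc *ᵥ x + T.Dc *ᵥ u))
    (hK0 : (K 0).PosDef) {ε : ℝ} (hε : 0 < ε)
    (hjump : ∀ x, (T.Ad *ᵥ x) ⬝ᵥ (K h *ᵥ (T.Ad *ᵥ x)) + ε * (x ⬝ᵥ x) ≤ x ⬝ᵥ (K 0 *ᵥ x)) :
    T.GES h := by
  have hnn : ∀ x : Fin n → ℝ, 0 ≤ x ⬝ᵥ x := fun x =>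
    Finset.sum_nonneg fun i _ => mul_self_nonneg _
  obtain ⟨μ, hμ, hμ0⟩ := exists_mul_dotProduct_le_quad (K 0)
  replace hμ0 : 0 < μ := hμ0 fun x hx => by simpa using hK0.dotProduct_mulVec_pos hx
  obtain ⟨β', hβ0, hβ'⟩ := exists_quad_le (K 0)
  obtain ⟨lam, hlam0, hlam⟩ := exists_quad_le T.Ac
  obtain ⟨D, hD0, hD⟩ := exists_quad_le (T.Adᵀ * T.Ad)
  -- The added `2 * ε` ensures `ε < β`, so that the contraction factor `1 - ε / β` is positive.
  set β := β' + 2 * ε with hβdef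
  have hβpos : 0 < β := by positivity
  have hβ : ∀ x : Fin n → ℝ, x ⬝ᵥ (K 0 *ᵥ x) ≤ β * (x ⬝ᵥ x) := fun x => by
    nlinarith [hβ' x, hnn x]
  have hρ : 0 < 1 - ε / β := by rw [sub_pos, div_lt_one hβpos]; linarith
  -- `C` compares the form of `K 0` with the Euclidean one from both sides; `L` combines the jump,
  -- bounded by `D`, with Grönwall growth over one period.
  refine ges_of_contraction hh (ρ := 1 - ε / β) (C := β / μ)
    (L := Real.exp (2 * lam * h) * D) hρ (by linarith [div_pos hε hβpos]) (by positivity)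
    (by positivity) fun ξ hξ => ?_
  have hfl : ∀ (k : ℕ) (t : ℝ), k * h < t → t ≤ (k + 1) * h → T.IsFlowOn (k * h) t
      (Function.update ξ (k * h) (T.Ad *ᵥ ξ (k * h))) (fun _ => 0) := fun k t h1 h2 => by
    have hk : (0 : ℝ) ≤ k * h := by positivity
    simpa using ((hξ t (hk.trans h1.le)).mono hk le_rfl).isFlowOn_update h1 h2
  constructor
  · have hstep : ∀ k : ℕ, ξ ((k + 1 : ℕ) * h) ⬝ᵥ (K 0 *ᵥ ξ ((k + 1 : ℕ) * h)) ≤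
        (1 - ε / β) * (ξ (k * h) ⬝ᵥ (K 0 *ᵥ ξ (k * h))) := fun k => by
      have hlt : (k : ℝ) * h < (k + 1) * h := by linarith
      have hq := (hfl k _ hlt le_rfl).quad_sub_le hlt.le
        (by linarith : ((k : ℝ) + 1) * h - k * h ≤ h) le_rfl hsc hK hK'
        fun r hr x _ => hflow r hr x 0
      have hint : ∫ t in (k * h : ℝ)..(k + 1) * h, sc 0 (T.Cc *ᵥ
          Function.update ξ (k * h) (T.Ad *ᵥ ξ (k * h)) t + T.Dc *ᵥ 0) ≤ 0 := by
        rw [← neg_nonneg, ← intervalIntegral.integral_neg]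
        exact intervalIntegral.integral_nonneg hlt.le fun t _ => neg_nonneg.2 (hsc0 _)
      have hle := hq.2.trans hint
      rw [Function.update_of_ne hlt.ne', Function.update_self, sub_self,
        show ((k : ℝ) + 1) * h - k * h = h by ring] at hle
      have hj := hjump (ξ (k * h))
      have hb : ε / β * (ξ (k * h) ⬝ᵥ (K 0 *ᵥ ξ (k * h))) ≤ ε * (ξ (k * h) ⬝ᵥ ξ (k * h)) := by
        rw [div_mul_eq_mul_div, div_le_iff₀ hβpos]
        nlinarith [hβ (ξ (k * h))]
      push_cast
      linarith
    have hpow : ∀ k : ℕ, ξ (k * h) ⬝ᵥ (K 0 *ᵥ ξ (k * h)) ≤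
        (1 - ε / β) ^ k * (ξ 0 ⬝ᵥ (K 0 *ᵥ ξ 0)) := fun k => by
      induction k with
      | zero => simp
      | succ k ih =>
        rw [pow_succ', mul_assoc]
        exact (hstep k).trans (mul_le_mul_of_nonneg_left ih hρ.le)
    intro k
    have h1 := (hμ (ξ (k * h))).trans ((hpow k).trans
      (mul_le_mul_of_nonneg_left (hβ (ξ 0)) (pow_pos hρ k).le))
    rw [div_mul_eq_mul_div, div_mul_eq_mul_div, le_div_iff₀ hμ0]
    linarith
  · intro k t h1 h2
    have hg := (hfl k t h1 h2).dotProduct_le (h := h) h1.le (by linarith)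
      (by positivity : 0 ≤ 2 * lam) fun x => by linarith [hlam x]
    rw [Function.update_of_ne h1.ne', Function.update_self] at hg
    have hd := hD (ξ (k * h))
    rw [← Matrix.mulVec_mulVec, dotProduct_transpose_mulVec_eq] at hd
    rw [mul_assoc]
    exact hg.trans (mul_le_mul_of_nonneg_left hd (Real.exp_pos _).le)

end LPJF

/-! ### Assembly of the main theorem. -/

theorem continuous_quadSupply {a b : ℕ} (Q : Matrix (Fin a) (Fin a) ℝ)
    (S : Matrix (Fin a) (Fin b) ℝ) (R : Matrix (Fin b) (Fin b) ℝ) :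
    Continuous (Function.uncurry (quadSupply Q S R)) := by
  have : Function.uncurry (quadSupply Q S R) = fun p : (Fin a → ℝ) × (Fin b → ℝ) =>
      p.1 ⬝ᵥ (Q *ᵥ p.1) + 2 * (p.1 ⬝ᵥ (S *ᵥ p.2)) + p.2 ⬝ᵥ (R *ᵥ p.2) :=
    funext fun p => quadSupply_eq Q S R p.1 p.2
  rw [this]
  fun_prop

theorem theorem3p1 {n wc wd zc zd e r q : ℕ} (T : LPJF n wc wd zc zd) (h : ℝ) (hh : 0 < h)
    (Qc : Matrix (Fin wc) (Fin wc) ℝ) (Sc : Matrix (Fin wc) (Fin zc) ℝ)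
    (Rc : Matrix (Fin zc) (Fin zc) ℝ)
    (Qd : Matrix (Fin wd) (Fin wd) ℝ) (Sd : Matrix (Fin wd) (Fin zd) ℝ)
    (Rd : Matrix (Fin zd) (Fin zd) ℝ)
    (Ed : Matrix (Fin e) (Fin zd) ℝ) (Pd : Matrix (Fin e) (Fin e) ℝ)
    (hQc : Qc.IsSymm) (hRc : Rc.IsSymm)
    (hPd : Pd.PosDef) (hRd : Rd = -(Edᵀ * Pd⁻¹ * Ed))
    (hM₂ : (T.M₂ Qc Sc Rc).PosDef)
    (hF : ∀ t ∈ Set.Icc 0 h, IsUnit (T.F Qc Sc Rc t).toBlocks₁₁)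
    (Bh : Matrix (Fin n) (Fin q) ℝ) (Ch : Matrix (Fin r) (Fin n) ℝ)
    (hBh : Bh * Bhᵀ = -((T.F Qc Sc Rc h).toBlocks₁₁⁻¹ * (T.F Qc Sc Rc h).toBlocks₁₂))
    (hCh : Chᵀ * Ch = (T.F Qc Sc Rc h).toBlocks₂₁ * (T.F Qc Sc Rc h).toBlocks₁₁⁻¹)
    (hLMI : ∃ P : Matrix (Fin n) (Fin n) ℝ,
      (T.lmi Qd Sd Ed Pd (T.F Qc Sc Rc h).toBlocks₁₁⁻¹ Bh Ch P).PosDef) :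
    T.Dissipative h (quadSupply Qc Sc Rc) (quadSupply Qd Sd Rd) ∧
      ((-Rc).PosSemidef → T.GES h) := by
  obtain ⟨P, hL⟩ := hLMI
  have hP : P.PosDef := T.lmi_posDef hL
  obtain ⟨A, hA⟩ : ∃ A, A = T.Ac - T.Bc * (T.M₂ Qc Sc Rc)⁻¹ * (T.M₃ Sc Rc)ᵀ := ⟨_, rfl⟩
  obtain ⟨N, hN⟩ : ∃ N, N = T.Bc * (T.M₂ Qc Sc Rc)⁻¹ * T.Bcᵀ := ⟨_, rfl⟩
  obtain ⟨M, hM⟩ : ∃ M, M = T.M₁ Rc - T.M₃ Sc Rc * (T.M₂ Qc Sc Rc)⁻¹ * (T.M₃ Sc Rc)ᵀ :=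
    ⟨_, rfl⟩
  have hH : T.hamiltonian Qc Sc Rc = fromBlocks A N M (-Aᵀ) := by
    rw [LPJF.hamiltonian, ← hA, ← hN, ← hM]
  have hNp : N.PosSemidef := by
    rw [hN, ← conjTranspose_eq_transpose_of_trivial]
    exact hM₂.inv.posSemidef.mul_mul_conjTranspose_same T.Bc
  have hM₂s : ((T.M₂ Qc Sc Rc)⁻¹)ᵀ = (T.M₂ Qc Sc Rc)⁻¹ := hM₂.inv.isSymm
  have hNs : N.IsSymm := by
    rw [hN, Matrix.IsSymm]
    simp only [Matrix.transpose_mul, Matrix.transpose_transpose, hM₂s, Matrix.mul_assoc]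
  have hMs : M.IsSymm := by
    rw [hM, Matrix.IsSymm]
    simp only [Matrix.transpose_sub, Matrix.transpose_mul, Matrix.transpose_transpose, hM₂s,
      Matrix.mul_assoc, (T.M₁_isSymm hRc).eq]
  have hFd : ∀ τ, HasDerivAt (T.F Qc Sc Rc) (-fromBlocks A N M (-Aᵀ) * T.F Qc Sc Rc τ) τ := by
    intro τ
    rw [← hH]
    exact hasDerivAt_exp_neg_smul _ τ
  have hFs : ∀ τ, T.F Qc Sc Rc τ ∈ symplecticGroup (Fin n) ℝ := fun τ => by
    rw [LPJF.F, hH]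
    exact exp_neg_smul_mem_symplecticGroup A hNs hMs τ
  have hF0 : T.F Qc Sc Rc 0 = 1 := by
    rw [LPJF.F, zero_smul, neg_zero, NormedSpace.exp_zero]
  have hX : ∀ τ ∈ Set.Icc 0 h,
      IsUnit ((T.F Qc Sc Rc τ).toBlocks₁₁ + (T.F Qc Sc Rc τ).toBlocks₁₂ * P) := fun τ hτ =>
    isUnit_toBlocks₁₁_add hFd hFs hNp hF
      (fun x hx => by rw [← hBh]; exact T.lmi_quad_lt hL x hx) hτ
  set K := riccati (T.F Qc Sc Rc) P with hKdef
  have hKd : ∀ τ ∈ Set.Icc 0 h,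
      HasDerivAt K (-M + Aᵀ * K τ + K τ * A + K τ * N * K τ) τ := fun τ hτ =>
    hasDerivAt_riccati (hFd τ) (hX τ hτ)
  have hKc : ContinuousOn K (Set.Icc 0 h) := fun τ hτ =>
    (hKd τ hτ).matrix_continuousAt.continuousWithinAt
  have hK'c : ContinuousOn (fun τ => -M + Aᵀ * K τ + K τ * A + K τ * N * K τ) (Set.Icc 0 h) := by
    fun_prop
  have hflow : ∀ τ ∈ Set.Icc 0 h, ∀ x u, (T.Ac *ᵥ x + T.Bc *ᵥ u) ⬝ᵥ (K τ *ᵥ x) +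
      x ⬝ᵥ (K τ *ᵥ (T.Ac *ᵥ x + T.Bc *ᵥ u)) +
      x ⬝ᵥ (-(-M + Aᵀ * K τ + K τ * A + K τ * N * K τ) *ᵥ x) ≤
        quadSupply Qc Sc Rc u (T.Cc *ᵥ x + T.Dc *ᵥ u) := fun τ hτ x u =>
    T.flow_dissipation hRc hM₂ (riccati_isSymm (hFs τ) hP.isSymm (hX τ hτ)) hA hN hM x u
  have hK0 : K 0 = P := riccati_zero hF0
  have hhI : h ∈ Set.Icc 0 h := Set.right_mem_Icc.2 hh.le
  obtain ⟨hU, hKh⟩ := riccati_eq (hFs h) (hF h hhI) (hX h hhI)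
  rw [← hBh] at hU
  rw [← hBh, ← hCh, ← hKdef] at hKh
  have hval : ∀ x v, ∃ u, Sum.elim (Sum.elim x v) u ⬝ᵥ
      (T.lmi Qd Sd Ed Pd (T.F Qc Sc Rc h).toBlocks₁₁⁻¹ Bh Ch P *ᵥ Sum.elim (Sum.elim x v) u) =
      x ⬝ᵥ (P *ᵥ x) + quadSupply Qd Sd Rd v (T.Cd *ᵥ x + T.Dd *ᵥ v) -
        (T.Ad *ᵥ x + T.Bd *ᵥ v) ⬝ᵥ (K h *ᵥ (T.Ad *ᵥ x + T.Bd *ᵥ v)) := fun x v => by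
    rw [hKh]
    exact T.exists_quad_lmi_eq hPd hRd hP.isSymm hU x v
  refine ⟨LPJF.dissipative_of_certificate hh (continuous_quadSupply Qc Sc Rc) hKd hK'c hflow
    fun x u => ?_, fun hR => ?_⟩
  · obtain ⟨y, hy⟩ := hval x u
    have := hL.posSemidef.dotProduct_mulVec_nonneg (Sum.elim (Sum.elim x u) y)
    rw [star_trivial, hy] at this
    rw [hK0]
    linarith
  -- A coercivity constant of the positive definite LMI matrix serves as the decay margin at jumps.
  · obtain ⟨ε, hε, hε0⟩ := exists_mul_dotProduct_le_quad
      (T.lmi Qd Sd Ed Pd (T.F Qc Sc Rc h).toBlocks₁₁⁻¹ Bh Ch P)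
    replace hε0 : 0 < ε := hε0 fun x hx => by simpa using hL.dotProduct_mulVec_pos hx
    refine LPJF.ges_of_certificate hh (continuous_quadSupply Qc Sc Rc) (fun z => ?_) hKd hK'c
      hflow (hK0 ▸ hP) hε0 fun x => ?_
    · have := hR.dotProduct_mulVec_nonneg z
      simp only [star_trivial, Matrix.neg_mulVec, dotProduct_neg] at this
      simp only [quadSupply_eq, zero_dotProduct, mul_zero, zero_add]
      linarith
    · obtain ⟨y, hy⟩ := hval x 0
      have h1 := hε (Sum.elim (Sum.elim x 0) y)
      rw [hy] at h1
      -- At zero disturbance the jump supply is `-(Ed z)ᵀ Pd⁻¹ (Ed z)`.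
      have h2 : quadSupply Qd Sd Rd 0 (T.Cd *ᵥ x + T.Dd *ᵥ 0) ≤ 0 := by
        have h3 := hPd.inv.posSemidef.dotProduct_mulVec_nonneg (Ed *ᵥ (T.Cd *ᵥ x))
        rw [quadSupply_eq, hRd]
        simp only [zero_dotProduct, mul_zero, zero_add, Matrix.mulVec_zero, add_zero,
          Matrix.neg_mulVec, dotProduct_neg, ← Matrix.mulVec_mulVec, dotProduct_transpose_mulVec_eq]
        simp only [star_trivial, Matrix.mulVec_mulVec] at h3 ⊢
        linarith
      -- The auxiliary components of the test vector only increase its norm, so the margin in `x`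
      -- survives.
      have h4 : x ⬝ᵥ x ≤ Sum.elim (Sum.elim x 0) y ⬝ᵥ Sum.elim (Sum.elim x (0 : Fin wd → ℝ)) y := by
        rw [sumElim_dotProduct_sumElim, sumElim_dotProduct_sumElim, zero_dotProduct, add_zero]
        exact le_add_of_nonneg_right (Finset.sum_nonneg fun i _ => mul_self_nonneg _)
      have h5 := mul_le_mul_of_nonneg_left h4 hε0.le
      simp only [Matrix.mulVec_zero, add_zero] at h1 h2
      rw [hK0]
      linarith
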